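/- Let $n\ge 1$, and write $|A|$ for the Lebesgue measure of $A\subset\mathbb R^n$. A convex body in $\mathbb R^n$ is a compact convex set with non-empty interior. For a convex body $K\subset\mathbb R^n$ put $h_{\infty,K}(y)=\max_{x\in K}\langle x,y\rangle$ and, for $p\in(0,\infty)$, $$h_{p,K}(y)=\log\Big(\Big(\frac1{|K|}\int_K e^{p\langle x,y\rangle}\,dx\Big)^{1/p}\Big),\qquad y\in\mathbb R^n.$$ For $p\in(0,\infty]$ the $L_p$ polar body of $K$ is $$K^{\circ,p}=\{y\in\mathbb R^n:\|y\|_{K^{\circ,p}}\le 1\},\qquad \|y\|_{K^{\circ,p}}=\Big(\frac1{(n-1)!}\int_0^\infty r^{n-1}e^{-h_{p,K}(ry)}\,dr\Big)^{-1/n},$$ where $\infty^{-1/n}=0$. For $A\subset\mathbb R^n$ let $A^\circ=\{y\in\mathbb R^n:\langle y,x\rangle\le1\text{ for all }x\in A\}$, let $\operatorname{bar}(A)=\frac1{|A|}\int_A x\,dx$ be the barycenter, let $\operatorname{conv}$ denote the convex hull, and let $A-B=\{a-b:a\in A,\ b\in B\}$. Theorem. Let $p\in(0,\infty]$ and let $K,L\subset\mathbb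 R^n$ be convex bodies with the origin in both of their interiors, such that $\operatorname{bar}(K^{\circ,p})=-\operatorname{bar}(L^{\circ,p})$. Then $$\binom{2n}{n}\,\big|\operatorname{conv}\big(K^{\circ,p}\cup L^{\circ,p}\big)\big|\cdot\Big|\Big(\big(K^{\circ,p}\big)^\circ-\big(L^{\circ,p}\big)^\circ\Big)^\circ\Big|\ \ge\ |K^{\circ,p}|\,|L^{\circ,p}|.$$ -/

import Mathlib

open MeasureTheory Set
open scoped ENNReal Pointwise Nat

noncomputable section

/-- The support function `h_K(y) = max {⟪x, y⟫ : x ∈ K}`. -/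
def supportFun {n : ℕ} (K : Set (EuclideanSpace ℝ (Fin n))) (y : EuclideanSpace ℝ (Fin n)) : ℝ :=
  sSup ((fun x => inner ℝ x y) '' K)

/-- The `L_p` support function
`h_{p,K}(y) = log ((|K|⁻¹ ∫_K e^{p⟪x, y⟫} dx)^{1/p})` for `0 < p < ∞`, and `h_{∞,K} = h_K`. -/
def lpSupportFun {n : ℕ} (p : ℝ≥0∞) (K : Set (EuclideanSpace ℝ (Fin n)))
    (y : EuclideanSpace ℝ (Fin n)) : ℝ :=
  if p = ∞ then supportFun K y
  else Real.log ((⨍ x in K, Real.exp (p.toReal * inner ℝ x y) ∂volume) ^ (1 / p.toReal))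

/-- The functional `‖y‖_{K^{∘,p}} = ((1 / (n-1)!) ∫_0^∞ r^{n-1} e^{-h_{p,K}(r y)} dr)^{-1/n}`
for `n ≥ 1`, with values in `[0, ∞]`: the integral of this nonnegative function is
infinite at `y = 0`, and there the value is `0`. -/
def lpPolarNorm {n : ℕ} (p : ℝ≥0∞) (K : Set (EuclideanSpace ℝ (Fin n)))
    (y : EuclideanSpace ℝ (Fin n)) : ℝ≥0∞ :=
  (((n - 1)! : ℝ≥0∞)⁻¹ *
    ∫⁻ r in Ioi (0 : ℝ), ENNReal.ofReal (r ^ (n - 1) * Real.exp (-lpSupportFun p K (r • y)))) ^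
      (-(1 / (n : ℝ)))

/-- The `L_p` polar body `K^{∘,p} = {y : ‖y‖_{K^{∘,p}} ≤ 1}`. -/
def lpPolar {n : ℕ} (p : ℝ≥0∞) (K : Set (EuclideanSpace ℝ (Fin n))) :
    Set (EuclideanSpace ℝ (Fin n)) :=
  {y | lpPolarNorm p K y ≤ 1}

/-- The polar `A^∘ = {y : ⟪y, x⟫ ≤ 1 for all x ∈ A}` with respect to the origin
(one-sided, so that it is the usual polar also for bodies which are not symmetric). -/
def polarBody {n : ℕ} (A : Set (EuclideanSpace ℝ (Fin n))) : Set (EuclideanSpace ℝ (Fin n)) :=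
  {y | ∀ x ∈ A, inner ℝ y x ≤ 1}

/-- The barycenter `|A|⁻¹ ∫_A x dx`. -/
def barycenter {n : ℕ} (A : Set (EuclideanSpace ℝ (Fin n))) : EuclideanSpace ℝ (Fin n) :=
  ⨍ x in A, x ∂volume

end

/-! Both `L_p` polar bodies are unit balls of gauges: `lpSupportFun` is convex (by Hölder for finite
`p`) and grows at least linearly because the origin is interior, and Ball's theorem
(`isGauge_ballNorm`) turns such a function into a gauge. From then on only two gauges `M`, `N`
matter, with unit balls `A`, `B` whose barycenters are opposite.

Consider the convex set `T = {(a, b) : M a + N b ≤ 1}` in dimension `2n`. Integrating over `b` and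
then over the levels of `M` gives `|T| = |A| |B| / binom(2n, n)`. Now fiber `T` by `z = a + b`. The
fiber volume `f z` is log-concave by Prékopa's theorem, vanishes off `C = conv (A ∪ B)`, and `f 0 =
|{a : M a + N (-a) ≤ 1}|`, a set contained in the polar of `A° - B°`.

The maximum of `f` need not be at `0`, so `|T| ≤ f 0 * |C|` is not immediate. Log-concavity does
give a linear `l` with `f z ≤ f 0 * exp (l z)` (`IsLogConcave.exists_le_mul_exp`). Since the
barycenters are opposite, `l (a + b)` has integral zero over `T`, so `|T| = ∫ f z * (1 - l z)`. The
inequality `1 - l z ≤ exp (-l z)` bounds the integrand by `f 0` on `C`, hence `|T| ≤ f 0 * |C|`. -/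

/-! ### Brunn–Minkowski and Prékopa–Leindler on the line -/

/-- One-dimensional Brunn–Minkowski inequality for compact sets. -/
theorem Real.volume_add_le_of_isCompact {A B C : Set ℝ} (hA : IsCompact A) (hB : IsCompact B)
    (hA' : A.Nonempty) (hB' : B.Nonempty) {a b : ℝ} (ha : 0 < a) (hb : 0 < b)
    (h : ∀ x ∈ A, ∀ y ∈ B, a * x + b * y ∈ C) :
    ENNReal.ofReal a * volume A + ENNReal.ofReal b * volume B ≤ volume C := by
  obtain ⟨x₀, hx₀, hx⟩ := hA.exists_isGreatest hA'
  obtain ⟨y₀, hy₀, hy⟩ := hB.exists_isLeast hB'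
  -- With `x₀ = max A` and `y₀ = min B`, the copies `a A + b y₀` and `a x₀ + b B` lie on either side
  -- of `a x₀ + b y₀` and meet only there, so their measures add up inside `C`.
  have hU : IsCompact ((fun x => a * x + b * y₀) '' A) := hA.image (by fun_prop)
  have hV : IsCompact ((fun y => a * x₀ + b * y) '' B) := hB.image (by fun_prop)
  have hUv : volume ((fun x => a * x + b * y₀) '' A) = ENNReal.ofReal a * volume A := by
    have : (fun x => a * x + b * y₀) '' A = (fun x => x + b * y₀) '' (a • A) := by
      rw [← image_smul, image_image]; rfl
    rw [this, image_add_right, measure_preimage_add_right, Measure.addHaar_smul]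
    simp [abs_of_pos ha]
  have hVv : volume ((fun y => a * x₀ + b * y) '' B) = ENNReal.ofReal b * volume B := by
    have : (fun y => a * x₀ + b * y) '' B = (fun y => a * x₀ + y) '' (b • B) := by
      rw [← image_smul, image_image]; rfl
    rw [this, image_add_left, measure_preimage_add, Measure.addHaar_smul]
    simp [abs_of_pos hb]
  rw [← hUv, ← hVv, ← measure_union₀ hV.measurableSet.nullMeasurableSet]
  · apply measure_mono
    rintro z (⟨x, hxA, rfl⟩ | ⟨y, hyB, rfl⟩)
    · exact h x hxA y₀ hy₀
    · exact h x₀ hx₀ y hyB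
  · refine measure_mono_null (t := {a * x₀ + b * y₀}) ?_ (by simp)
    rintro z ⟨⟨x, hxA, rfl⟩, ⟨y, hyB, hxy⟩⟩
    have h1 := hx hxA
    have h2 := hy hyB
    simp only [mem_singleton_iff] at hxy ⊢
    nlinarith

/-- One-dimensional Brunn–Minkowski inequality. -/
theorem Real.volume_add_le {A B C : Set ℝ} (hA : MeasurableSet A) (hB : MeasurableSet B)
    (hA' : A.Nonempty) (hB' : B.Nonempty) {a b : ℝ} (ha : 0 < a) (hb : 0 < b)
    (h : ∀ x ∈ A, ∀ y ∈ B, a * x + b * y ∈ C) :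
    ENNReal.ofReal a * volume A + ENNReal.ofReal b * volume B ≤ volume C := by
  obtain ⟨x₀, hx₀⟩ := hA'
  obtain ⟨y₀, hy₀⟩ := hB'
  have key : ∀ X ⊆ A, IsCompact X → ∀ Y ⊆ B, IsCompact Y →
      ENNReal.ofReal a * volume X + ENNReal.ofReal b * volume Y ≤ volume C := by
    intro X hX hXc Y hY hYc
    -- Compact subsets may be empty; adjoining a fixed point of `A` and of `B` makes the compact
    -- case applicable.
    refine le_trans ?_ (Real.volume_add_le_of_isCompact (hXc.insert x₀) (hYc.insert y₀)
      (insert_nonempty _ _) (insert_nonempty _ _) ha hb fun x hx y hy =>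
        h x (insert_subset hx₀ hX hx) y (insert_subset hy₀ hY hy))
    gcongr <;> exact subset_insert _ _
  have sup : ∀ {X : Set ℝ}, MeasurableSet X →
      volume X = ⨆ Y : {Y : Set ℝ // Y ⊆ X ∧ IsCompact Y}, volume (Y : Set ℝ) := by
    intro X hX
    rw [hX.measure_eq_iSup_isCompact, iSup_subtype]
    simp only [iSup_and]
  have ne : ∀ X : Set ℝ, Nonempty {Y : Set ℝ // Y ⊆ X ∧ IsCompact Y} := fun X =>
    ⟨⟨∅, empty_subset _, isCompact_empty⟩⟩
  have := ne A
  have := ne B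
  rw [sup hA, sup hB, ENNReal.mul_iSup, ENNReal.mul_iSup]
  exact ENNReal.iSup_add_iSup_le fun X Y => key X X.2.1 X.2.2 Y Y.2.1 Y.2.2

/-- Weighted arithmetic-geometric mean inequality. -/
theorem ENNReal.rpow_mul_rpow_le_add {a b : ℝ} (ha : 0 < a) (hb : 0 < b) (hab : a + b = 1)
    (x y : ℝ≥0∞) : x ^ a * y ^ b ≤ ENNReal.ofReal a * x + ENNReal.ofReal b * y := by
  have hpq : (a⁻¹).HolderConjugate b⁻¹ := by
    rw [Real.holderConjugate_iff]
    constructor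
    · exact (one_lt_inv₀ ha).2 (by linarith)
    · simpa using hab
  have h := ENNReal.young_inequality (x ^ a) (y ^ b) hpq
  rw [← ENNReal.rpow_mul, ← ENNReal.rpow_mul, mul_inv_cancel₀ ha.ne', mul_inv_cancel₀ hb.ne',
    ENNReal.rpow_one, ENNReal.rpow_one, ENNReal.ofReal_inv_of_pos ha, ENNReal.ofReal_inv_of_pos hb,
    div_eq_mul_inv, div_eq_mul_inv, inv_inv, inv_inv] at h
  rwa [mul_comm (ENNReal.ofReal a), mul_comm (ENNReal.ofReal b)]

/-- Layer cake, cut off at height one because higher superlevel sets are empty. Below that height,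
functions of supremum one have nonempty superlevel sets, as Brunn–Minkowski requires. -/
theorem lintegral_eq_lintegral_meas_lt_of_le_one {F : ℝ → ℝ≥0∞} (hF : Measurable F)
    (h1 : ∀ x, F x ≤ 1) :
    ∫⁻ x, F x = ∫⁻ t in Ioo (0 : ℝ) 1, volume {x | ENNReal.ofReal t < F x} := by
  have hfin : ∀ x, F x ≠ ∞ := fun x => ne_top_of_le_ne_top ENNReal.one_ne_top (h1 x)
  have h := lintegral_eq_lintegral_meas_lt (f := fun x => (F x).toReal) (volume : Measure ℝ)
    (Filter.Eventually.of_forall fun x => ENNReal.toReal_nonneg) hF.ennreal_toReal.aemeasurable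
  simp only [ENNReal.ofReal_toReal (hfin _)] at h
  rw [h, ← Ioo_union_Ici_eq_Ioi (zero_lt_one' ℝ), lintegral_union measurableSet_Ici
    (by rw [Set.disjoint_left]; intro x hx hx'; exact absurd hx.2 (not_lt.2 hx'))]
  have h0 : ∫⁻ t in Ici (1 : ℝ), volume {x | t < (F x).toReal} = 0 := by
    rw [setLIntegral_congr_fun (g := fun _ => 0) measurableSet_Ici, lintegral_zero]
    intro t ht
    have : {x | t < (F x).toReal} = ∅ := by
      ext x
      simp only [mem_ofPred_eq, mem_empty_iff_false, iff_false, not_lt]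
      exact (ENNReal.toReal_mono ENNReal.one_ne_top (h1 x)).trans (by simpa using ht)
    simp [this]
  rw [h0, add_zero]
  refine setLIntegral_congr_fun measurableSet_Ioo fun t ht => ?_
  congr 1
  ext x
  simp only [mem_ofPred_eq]
  rw [ENNReal.ofReal_lt_iff_lt_toReal ht.1.le (hfin x)]

/-- Prékopa–Leindler inequality on the line for functions with supremum one. -/
theorem prekopa_leindler_real_of_sup_eq_one {F G H : ℝ → ℝ≥0∞} (hF : Measurable F)
    (hG : Measurable G) (hH : Measurable H) (hF1 : ∀ x, F x ≤ 1) (hG1 : ∀ x, G x ≤ 1)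
    (hFs : ∀ t < 1, ∃ x, t < F x) (hGs : ∀ t < 1, ∃ x, t < G x)
    {a b : ℝ} (ha : 0 < a) (hb : 0 < b) (hab : a + b = 1)
    (h : ∀ x y, F x ^ a * G y ^ b ≤ H (a * x + b * y)) :
    (∫⁻ x, F x) ^ a * (∫⁻ x, G x) ^ b ≤ ∫⁻ x, H x := by
  -- The arithmetic mean is linear in the measures of superlevel sets, so it suffices to compare
  -- these at each level. Truncating `H` at `1` costs nothing at levels below one.
  refine (ENNReal.rpow_mul_rpow_le_add ha hb hab _ _).trans ?_
  have hHle : ∫⁻ x, min (H x) 1 ≤ ∫⁻ x, H x := lintegral_mono fun x => min_le_left _ _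
  refine le_trans ?_ hHle
  have meas : ∀ F : ℝ → ℝ≥0∞, Measurable fun t : ℝ => volume {x | ENNReal.ofReal t < F x} := by
    intro F
    apply Antitone.measurable
    intro s t hst
    exact measure_mono fun x hx => (ENNReal.ofReal_le_ofReal hst).trans_lt hx
  rw [lintegral_eq_lintegral_meas_lt_of_le_one hF hF1,
    lintegral_eq_lintegral_meas_lt_of_le_one hG hG1,
    lintegral_eq_lintegral_meas_lt_of_le_one (hH.min measurable_const) fun x => min_le_right _ _,
    ← lintegral_const_mul _ (meas F), ← lintegral_const_mul _ (meas G),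
    ← lintegral_add_left ((meas F).const_mul _)]
  refine setLIntegral_mono' measurableSet_Ioo fun t ht => ?_
  have ht1 : ENNReal.ofReal t < 1 := by simpa using ht.2
  have ht0 : ENNReal.ofReal t ≠ 0 := by simpa using ht.1
  refine Real.volume_add_le (measurableSet_lt measurable_const hF)
    (measurableSet_lt measurable_const hG) (hFs _ ht1) (hGs _ ht1) ha hb ?_
  intro x hx y hy
  simp only [mem_ofPred_eq, lt_min_iff] at hx hy ⊢
  refine ⟨lt_of_lt_of_le ?_ (h x y), ht1⟩
  calc ENNReal.ofReal t = ENNReal.ofReal t ^ a * ENNReal.ofReal t ^ b := by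
        rw [← ENNReal.rpow_add _ _ ht0 ENNReal.ofReal_ne_top, hab, ENNReal.rpow_one]
    _ < F x ^ a * G y ^ b :=
        ENNReal.mul_lt_mul (ENNReal.rpow_lt_rpow hx ha) (ENNReal.rpow_lt_rpow hy hb)

/-- Prékopa–Leindler inequality on the line for bounded functions. -/
theorem prekopa_leindler_real {F G H : ℝ → ℝ≥0∞} (hF : Measurable F)
    (hG : Measurable G) (hH : Measurable H) {C : ℝ≥0∞} (hC : C ≠ ∞) (hFC : ∀ x, F x ≤ C)
    (hGC : ∀ x, G x ≤ C) {a b : ℝ} (ha : 0 < a) (hb : 0 < b) (hab : a + b = 1)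
    (h : ∀ x y, F x ^ a * G y ^ b ≤ H (a * x + b * y)) :
    (∫⁻ x, F x) ^ a * (∫⁻ x, G x) ^ b ≤ ∫⁻ x, H x := by
  set m := ⨆ x, F x with hm
  set m' := ⨆ x, G x with hm'
  have hmt : m ≠ ∞ := ne_top_of_le_ne_top hC (iSup_le hFC)
  have hmt' : m' ≠ ∞ := ne_top_of_le_ne_top hC (iSup_le hGC)
  rcases eq_or_ne m 0 with h0 | h0
  · have : ∀ x, F x = 0 := fun x => le_antisymm ((le_iSup F x).trans h0.le) bot_le
    simp [this, ENNReal.zero_rpow_of_pos ha]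
  rcases eq_or_ne m' 0 with h0' | h0'
  · have : ∀ x, G x = 0 := fun x => le_antisymm ((le_iSup G x).trans h0'.le) bot_le
    simp [this, ENNReal.zero_rpow_of_pos hb]
  have hsup : ∀ (F : ℝ → ℝ≥0∞), (⨆ x, F x) ≠ 0 → (⨆ x, F x) ≠ ∞ →
      ∀ t < 1, ∃ x, t < (⨆ x, F x)⁻¹ * F x := by
    intro F h0 ht t ht1
    have : (⨆ x, F x) * t < ⨆ x, F x := by
      conv_rhs => rw [← mul_one (⨆ x, F x)]
      exact (ENNReal.mul_lt_mul_iff_right h0 ht).2 ht1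
    obtain ⟨x, hx⟩ := lt_iSup_iff.1 this
    refine ⟨x, ?_⟩
    rw [← ENNReal.mul_lt_mul_iff_right h0 ht, ← mul_assoc, ENNReal.mul_inv_cancel h0 ht, one_mul]
    exact hx
  have hle : ∀ (F : ℝ → ℝ≥0∞), ∀ x, (⨆ x, F x)⁻¹ * F x ≤ 1 := by
    intro F x
    rw [mul_comm, ← div_eq_mul_inv]
    exact ENNReal.div_le_of_le_mul (by simpa using le_iSup F x)
  -- The hypothesis is homogeneous: `F` and `G` are divided by their suprema, and `H` by the
  -- corresponding geometric mean.
  have key := prekopa_leindler_real_of_sup_eq_one (F := fun x => m⁻¹ * F x)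
    (G := fun x => m'⁻¹ * G x) (H := fun x => (m⁻¹ ^ a * m'⁻¹ ^ b) * H x) (hF.const_mul _)
    (hG.const_mul _) (hH.const_mul _) (hle F) (hle G) (hsup F h0 hmt) (hsup G h0' hmt') ha hb hab
    (by
      intro x y
      rw [ENNReal.mul_rpow_of_nonneg _ _ ha.le, ENNReal.mul_rpow_of_nonneg _ _ hb.le,
        mul_mul_mul_comm]
      gcongr
      exact h x y)
  rw [lintegral_const_mul _ hF, lintegral_const_mul _ hG, lintegral_const_mul _ hH,
    ENNReal.mul_rpow_of_nonneg _ _ ha.le, ENNReal.mul_rpow_of_nonneg _ _ hb.le,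
    mul_mul_mul_comm] at key
  refine (ENNReal.mul_le_mul_iff_right ?_ ?_).1 key
  · refine mul_ne_zero ?_ ?_ <;>
      simp [ENNReal.rpow_eq_zero_iff, ha, hb, hmt, hmt', h0, h0']
  · refine ENNReal.mul_ne_top ?_ ?_ <;>
      simp [ENNReal.rpow_eq_top_iff, ha, hb, hmt, hmt', h0, h0']

/-! ### Log-concave functions and Prékopa's theorem -/

/-- Multiplicative form of concavity of the logarithm, for functions with values in `[0, ∞]`. -/
def IsLogConcave {V : Type*} [AddCommGroup V] [Module ℝ V] (f : V → ℝ≥0∞) : Prop :=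
  ∀ x y : V, ∀ a b : ℝ, 0 < a → 0 < b → a + b = 1 → f x ^ a * f y ^ b ≤ f (a • x + b • y)

/-- Prékopa's theorem: marginals of log-concave functions are log-concave. -/
theorem IsLogConcave.lintegral_pi (k : ℕ) {V : Type*} [AddCommGroup V] [Module ℝ V]
    (f : V × (Fin k → ℝ) → ℝ≥0∞) (hf : IsLogConcave f) (hm : ∀ v, Measurable fun x => f (v, x))
    {C : ℝ≥0∞} (hC : C ≠ ∞) (hfC : ∀ z, f z ≤ C) {R : ℝ}
    (hR : ∀ v x, x ∉ Metric.closedBall (0 : Fin k → ℝ) R → f (v, x) = 0) :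
    IsLogConcave fun v => ∫⁻ x, f (v, x) := by
  induction k generalizing V with
  | zero =>
    intro x y a b ha hb hab
    have := hf (x, default) (y, default) a b ha hb hab
    have e : ∀ v, ∫⁻ x, f (v, x) = f (v, default) := by
      intro v
      rw [volume_pi, Measure.pi_of_empty _ default, lintegral_dirac]
    simpa only [e, Prod.smul_mk, Prod.mk_add_mk, eq_iff_true_of_subsingleton,
      Subsingleton.elim (a • (default : Fin 0 → ℝ) + b • default) default] using this
  | succ k ih =>
    have he : ∀ q : ℝ × (Fin k → ℝ),
        (MeasurableEquiv.piFinSuccAbove (fun _ : Fin (k + 1) => ℝ) 0).symm q =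
          Fin.cons q.1 q.2 := fun q => Fin.insertNth_zero' q.1 q.2
    have hcons : ∀ v, ∫⁻ x, f (v, x) = ∫⁻ t : ℝ, ∫⁻ x : Fin k → ℝ, f (v, Fin.cons t x) := by
      intro v
      have e := (volume_preserving_piFinSuccAbove (fun _ : Fin (k + 1) => ℝ) 0).symm
      rw [← e.lintegral_comp (hm v), Measure.volume_eq_prod, lintegral_prod]
      · simp only [he]
      · exact ((hm v).comp e.measurable).aemeasurable
    have hmc : ∀ v, Measurable fun q : ℝ × (Fin k → ℝ) => f (v, Fin.cons q.1 q.2) := by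
      intro v
      have := (hm v).comp
        (MeasurableEquiv.piFinSuccAbove (fun _ : Fin (k + 1) => ℝ) 0).symm.measurable
      simpa only [Function.comp_def, he] using this
    have hmem : ∀ (t : ℝ) (x : Fin k → ℝ), x ∉ Metric.closedBall (0 : Fin k → ℝ) R →
        (Fin.cons t x : Fin (k + 1) → ℝ) ∉ Metric.closedBall (0 : Fin (k + 1) → ℝ) R := by
      intro t x hx hx'
      refine hx ?_
      rw [mem_closedBall_zero_iff] at hx' ⊢
      refine le_trans ?_ hx'
      rw [pi_norm_le_iff_of_nonneg (norm_nonneg _)]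
      intro i
      simpa using norm_le_pi_norm (Fin.cons t x : Fin (k + 1) → ℝ) i.succ
    -- The first coordinate joins the parameter space, so the inner marginal is log-concave jointly
    -- in the parameter and that coordinate; the inequality on the line then integrates the
    -- coordinate out.
    have hG := ih (V := V × ℝ) (fun z => f (z.1.1, Fin.cons z.1.2 z.2)) (by
      intro x y a b ha hb hab
      have := hf (x.1.1, Fin.cons x.1.2 x.2) (y.1.1, Fin.cons y.1.2 y.2) a b ha hb hab
      refine this.trans_eq ?_
      simp only [Prod.smul_mk, Prod.mk_add_mk, Prod.fst_add, Prod.snd_add, Prod.smul_fst,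
        Prod.smul_snd]
      congr 2
      ext i
      refine Fin.cases ?_ (fun i => ?_) i <;> simp)
      (fun v => (hmc v.1).comp (measurable_prodMk_left (x := v.2)))
      (fun z => hfC _) (fun v x hx => hR _ _ (hmem _ _ hx))
    -- Prékopa–Leindler on the line is available for bounded functions; the bound `C` and the common
    -- bounded support keep the inner marginals bounded.
    have hbound : ∀ v t, ∫⁻ x : Fin k → ℝ, f (v, Fin.cons t x) ≤
        C * volume (Metric.closedBall (0 : Fin k → ℝ) R) := by
      intro v t
      rw [← setLIntegral_const, ← lintegral_indicator Metric.isClosed_closedBall.measurableSet]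
      refine lintegral_mono fun x => ?_
      by_cases hx : x ∈ Metric.closedBall (0 : Fin k → ℝ) R
      · rw [indicator_of_mem hx]; exact hfC _
      · rw [hR _ _ (hmem t x hx)]; exact bot_le
    intro x y a b ha hb hab
    simp only [hcons]
    refine prekopa_leindler_real (hmc x).lintegral_prod_right' (hmc y).lintegral_prod_right'
      (hmc _).lintegral_prod_right'
      (ENNReal.mul_ne_top hC (isCompact_closedBall _ _).measure_lt_top.ne)
      (hbound x) (hbound y) ha hb hab fun s t => ?_
    exact hG (x, s) (y, t) a b ha hb hab

/-! ### Gauges and their unit balls -/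

/-- A positively homogeneous subadditive function bounded below by a multiple of the norm. -/
structure IsGauge {E : Type*} [NormedAddCommGroup E] [NormedSpace ℝ E] (N : E → ℝ) : Prop where
  smul : ∀ t : ℝ, 0 ≤ t → ∀ x, N (t • x) = t * N x
  add_le : ∀ x y, N (x + y) ≤ N x + N y
  lower : ∃ c > 0, ∀ x, c * ‖x‖ ≤ N x

namespace IsGauge

section Basic

variable {E : Type*} [NormedAddCommGroup E] [NormedSpace ℝ E] {M N : E → ℝ}

theorem zero (hN : IsGauge N) : N 0 = 0 := by
  simpa using hN.smul 0 le_rfl 0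

theorem nonneg (hN : IsGauge N) (x : E) : 0 ≤ N x := by
  obtain ⟨c, hc, h⟩ := hN.lower
  exact (by positivity : 0 ≤ c * ‖x‖).trans (h x)

theorem convexOn (hN : IsGauge N) : ConvexOn ℝ univ N := by
  refine ⟨convex_univ, fun x _ y _ a b ha hb _ => ?_⟩
  refine (hN.add_le _ _).trans_eq ?_
  rw [hN.smul a ha, hN.smul b hb]
  rfl

theorem continuous [FiniteDimensional ℝ E] (hN : IsGauge N) : Continuous N :=
  continuousOn_univ.1 (hN.convexOn.continuousOn isOpen_univ)

theorem isCompact_le [FiniteDimensional ℝ E] (hN : IsGauge N) (t : ℝ) :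
    IsCompact {x | N x ≤ t} := by
  obtain ⟨c, hc, h⟩ := hN.lower
  refine Metric.isCompact_of_isClosed_isBounded (isClosed_le hN.continuous continuous_const)
    (Metric.isBounded_closedBall (x := (0 : E)) (r := t / c) |>.subset fun x hx => ?_)
  rw [mem_closedBall_zero_iff, le_div_iff₀ hc, mul_comm]
  exact (h x).trans hx

theorem setOf_le (hN : IsGauge N) {t : ℝ} (ht : 0 < t) :
    {x | N x ≤ t} = t • {x | N x ≤ 1} := by
  ext x
  rw [mem_smul_set_iff_inv_smul_mem₀ ht.ne']
  simp only [mem_ofPred_eq]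
  rw [hN.smul _ (inv_nonneg.2 ht.le), inv_mul_le_iff₀ ht, mul_one]

/-- The unit ball of the gauge `(a, b) ↦ M a + N b` is compact. -/
theorem isCompact_add_le [FiniteDimensional ℝ E] (hM : IsGauge M) (hN : IsGauge N) :
    IsCompact {q : E × E | M q.1 + N q.2 ≤ 1} := by
  have hMc := hM.continuous
  have hNc := hN.continuous
  refine ((hM.isCompact_le 1).prod (hN.isCompact_le 1)).of_isClosed_subset
    (isClosed_le (by fun_prop) continuous_const) fun q hq => ?_
  have h1 := hM.nonneg q.1
  have h2 := hN.nonneg q.2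
  simp only [mem_ofPred_eq] at hq
  exact ⟨by simp only [mem_ofPred_eq]; linarith, by simp only [mem_ofPred_eq]; linarith⟩

/-- The shear `(a, b) ↦ (a, a + b)` carries the unit ball of `M a + N b` onto this set, whose second
coordinate is the fibering variable. -/
theorem isCompact_add_sub_le [FiniteDimensional ℝ E] (hM : IsGauge M) (hN : IsGauge N) :
    IsCompact {q : E × E | M q.1 + N (q.2 - q.1) ≤ 1} := by
  have : {q : E × E | M q.1 + N (q.2 - q.1) ≤ 1} =
      (fun q : E × E => (q.1, q.1 + q.2)) '' {q : E × E | M q.1 + N q.2 ≤ 1} := by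
    ext q
    constructor
    · intro hq
      exact ⟨(q.1, q.2 - q.1), hq, by simp⟩
    · rintro ⟨r, hr, rfl⟩
      simpa using hr
  rw [this]
  exact (hM.isCompact_add_le hN).image (by fun_prop)

/-- Elements of the image of the unit ball of `(a, b) ↦ M a + N b` under addition lie in the convex
hull of the union of the two unit balls. -/
theorem add_mem_convexHull (hM : IsGauge M) (hN : IsGauge N) {a b : E} (h : M a + N b ≤ 1) :
    a + b ∈ convexHull ℝ ({x | M x ≤ 1} ∪ {x | N x ≤ 1}) := by
  set C := convexHull ℝ ({x | M x ≤ 1} ∪ {x | N x ≤ 1})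
  have hC : Convex ℝ C := convex_convexHull _ _
  have h1 : ∀ x, M x ≤ 1 → x ∈ C := fun x hx => subset_convexHull _ _ (Or.inl hx)
  have h2 : ∀ x, N x ≤ 1 → x ∈ C := fun x hx => subset_convexHull _ _ (Or.inr hx)
  have a0 := hM.nonneg a
  have b0 := hN.nonneg b
  have eq0 : ∀ {N : E → ℝ}, IsGauge N → ∀ x, N x = 0 → x = 0 := by
    intro N hN x hx
    obtain ⟨c, hc, h⟩ := hN.lower
    have := h x
    rw [hx] at this
    exact norm_le_zero_iff.1 (nonpos_of_mul_nonpos_right this hc)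
  rcases a0.eq_or_lt with ha | ha
  · rw [eq0 hM a ha.symm, zero_add]
    exact h2 b (by linarith)
  rcases b0.eq_or_lt with hb | hb
  · rw [eq0 hN b hb.symm, add_zero]
    exact h1 a (by linarith)
  have e1 : (M a)⁻¹ • a ∈ C := h1 _ (by
    rw [hM.smul _ (inv_nonneg.2 a0), inv_mul_cancel₀ ha.ne'])
  have e2 : (N b)⁻¹ • b ∈ C := h2 _ (by
    rw [hN.smul _ (inv_nonneg.2 b0), inv_mul_cancel₀ hb.ne'])
  have h0 : (0 : E) ∈ C := h1 _ (by rw [hM.zero]; exact zero_le_one)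
  -- `a + b` is the combination of `a / M a`, `b / N b` and `0` with weights `M a`, `N b` and the
  -- remaining mass; hence the separate treatment of vanishing `M a` or `N b`.
  have := hC.sum_mem (t := Finset.univ) (w := ![M a, N b, 1 - M a - N b])
    (z := ![(M a)⁻¹ • a, (N b)⁻¹ • b, 0]) (by
      intro i _
      fin_cases i
      · exact a0
      · exact b0
      · show 0 ≤ 1 - M a - N b
        linarith) (by simp [Fin.sum_univ_three]) (by
      intro i _
      fin_cases i
      · exact e1
      · exact e2
      · exact h0)
  simpa [Fin.sum_univ_three, smul_smul, ha.ne', hb.ne'] using this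

end Basic

end IsGauge

/-! ### Exponential majorants of log-concave functions -/

/-- A log-concave function has an exponential majorant touching it at an interior point of its
support. -/
theorem IsLogConcave.exists_le_mul_exp {E : Type*} [NormedAddCommGroup E] [NormedSpace ℝ E]
    [FiniteDimensional ℝ E] {f : E → ℝ≥0∞} (hf : IsLogConcave f) (htop : ∀ z, f z ≠ ∞) {r : ℝ}
    (hr : 0 < r) (hpos : ∀ z ∈ Metric.ball (0 : E) r, f z ≠ 0) :
    ∃ l : E →L[ℝ] ℝ, ∀ z, (f z).toReal ≤ (f 0).toReal * Real.exp (l z) := by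
  set U := Metric.ball (0 : E) r
  set g : E → ℝ := fun z => Real.log (f z).toReal
  have h0U : (0 : E) ∈ U := Metric.mem_ball_self hr
  have hp : ∀ z ∈ U, 0 < (f z).toReal := fun z hz => ENNReal.toReal_pos (hpos z hz) (htop z)
  have hlc : ∀ x y : E, ∀ a b : ℝ, 0 < a → 0 < b → a + b = 1 →
      (f x).toReal ^ a * (f y).toReal ^ b ≤ (f (a • x + b • y)).toReal := by
    intro x y a b ha hb hab
    have := ENNReal.toReal_mono (htop _) (hf x y a b ha hb hab)
    rwa [ENNReal.toReal_mul, ← ENNReal.toReal_rpow, ← ENNReal.toReal_rpow] at this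
  have hconc : ConcaveOn ℝ U g := by
    refine concaveOn_iff_forall_pos.2 ⟨convex_ball _ _, fun x hx y hy a b ha hb hab => ?_⟩
    have h := Real.log_le_log (mul_pos (Real.rpow_pos_of_pos (hp x hx) a)
      (Real.rpow_pos_of_pos (hp y hy) b)) (hlc x y a b ha hb hab)
    rwa [Real.log_mul (Real.rpow_pos_of_pos (hp x hx) _).ne' (Real.rpow_pos_of_pos (hp y hy) _).ne',
      Real.log_rpow (hp x hx), Real.log_rpow (hp y hy)] at h
  have hcont : ContinuousOn g U := hconc.continuousOn Metric.isOpen_ball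
  -- The strict hypograph of `log f` over the ball is open and convex; a hyperplane separating it
  -- from `(0, log (f 0))` is the graph of the required affine majorant.
  set S : Set (E × ℝ) := {p | p.1 ∈ U ∧ p.2 < g p.1}
  have hSconv : Convex ℝ S := hconc.convex_strict_hypograph
  have hSopen : IsOpen S := by
    have : S = (U ×ˢ univ) ∩ (fun p : E × ℝ => g p.1 - p.2) ⁻¹' Ioi 0 := by
      ext p
      simp [S]
    rw [this]
    refine ContinuousOn.isOpen_inter_preimage ?_ (Metric.isOpen_ball.prod isOpen_univ) isOpen_Ioi
    exact (hcont.comp continuousOn_fst fun p hp => hp.1).sub continuousOn_snd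
  obtain ⟨F, hF⟩ := geometric_hahn_banach_open_point hSconv hSopen
    (x := ((0 : E), g 0)) (fun h => lt_irrefl _ h.2)
  have hsplit : ∀ z t, F (z, t) = F (z, 0) + t * F (0, 1) := by
    intro z t
    rw [← smul_eq_mul, ← map_smul, ← map_add]
    simp
  set c := F ((0 : E), (1 : ℝ))
  -- The hyperplane is not vertical, because `S` contains a point directly below `(0, g 0)`.
  have hc : 0 < c := by
    have := hF ((0 : E), g 0 - 1) ⟨h0U, by simp⟩
    rw [hsplit, hsplit 0 (g 0)] at this
    linarith
  have hle : ∀ z ∈ U, g z ≤ g 0 - F (z, 0) / c := by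
    intro z hz
    refine le_of_forall_lt fun t ht => ?_
    have := hF (z, t) ⟨hz, ht⟩
    rw [hsplit, hsplit 0 (g 0)] at this
    have h00 : F ((0 : E), (0 : ℝ)) = 0 := map_zero F
    rw [h00] at this
    rw [lt_sub_iff_add_lt, ← lt_sub_iff_add_lt', div_lt_iff₀ hc]
    linarith
  refine ⟨-(c⁻¹ • F.comp (ContinuousLinearMap.inl ℝ E ℝ)), fun z => ?_⟩
  set l : E →L[ℝ] ℝ := -(c⁻¹ • F.comp (ContinuousLinearMap.inl ℝ E ℝ))
  have hl : ∀ z, l z = -(F (z, 0) / c) := by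
    intro z
    simp [l, div_eq_inv_mul]
  rcases eq_or_ne (f z) 0 with hz0 | hz0
  · rw [hz0]
    simp only [ENNReal.toReal_zero]
    positivity
  have hzp : 0 < (f z).toReal := ENNReal.toReal_pos hz0 (htop z)
  -- Outside the ball, `z` is shrunk to `s • z` inside it; log-concavity on the segment from `0` to
  -- `z` transfers the bound at `s • z` back to `z`.
  obtain ⟨s, hs0, hs1, hsU⟩ : ∃ s : ℝ, 0 < s ∧ s < 1 ∧ s • z ∈ U := by
    refine ⟨r / (r + ‖z‖ + 1), by positivity, ?_, ?_⟩
    · rw [div_lt_one (by positivity)]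
      linarith [norm_nonneg z]
    · rw [mem_ball_zero_iff, norm_smul, Real.norm_of_nonneg (by positivity), div_mul_eq_mul_div,
        div_lt_iff₀ (by positivity)]
      nlinarith [norm_nonneg z]
  have h1 := hlc z 0 s (1 - s) hs0 (by linarith) (by ring)
  rw [smul_zero, add_zero] at h1
  have h2 := hle _ hsU
  have h3 : Real.log ((f z).toReal ^ s * (f 0).toReal ^ (1 - s)) ≤ g (s • z) :=
    Real.log_le_log (mul_pos (Real.rpow_pos_of_pos hzp _) (Real.rpow_pos_of_pos (hp 0 h0U) _)) h1
  rw [Real.log_mul (Real.rpow_pos_of_pos hzp _).ne' (Real.rpow_pos_of_pos (hp 0 h0U) _).ne',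
    Real.log_rpow hzp, Real.log_rpow (hp 0 h0U)] at h3
  have h4 : l (s • z) = s * l z := by simp
  rw [sub_eq_add_neg, ← hl, h4] at h2
  have h5 : Real.log (f z).toReal ≤ g 0 + l z := by
    have : s * Real.log (f z).toReal ≤ s * (g 0 + l z) := by
      simp only [g] at h2 h3 ⊢
      linarith
    exact le_of_mul_le_mul_left this hs0
  rw [← Real.exp_log hzp, ← Real.exp_log (hp 0 h0U), ← Real.exp_add]
  exact Real.exp_le_exp.2 h5

/-! ### The beta integral behind the binomial coefficient -/

/-- The integral is `n * B(n + 1, n) = n! * n! / (2n)!`, by the Gamma function formula for the beta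
integral. -/
theorem integral_mul_one_sub_pow_mul_pow {n : ℕ} (hn : 1 ≤ n) :
    ∫ t in (0 : ℝ)..1, n * (1 - t) ^ (n - 1) * t ^ n = ((2 * n).choose n : ℝ)⁻¹ := by
  obtain ⟨m, rfl⟩ : ∃ m, n = m + 1 := ⟨n - 1, by omega⟩
  have h := Complex.Gamma_mul_Gamma_eq_betaIntegral (s := ((m + 1 : ℕ) : ℂ) + 1)
    (t := ((m : ℕ) : ℂ) + 1) (by simp; positivity) (by simp; positivity)
  rw [show (((m + 1 : ℕ) : ℂ) + 1) + (((m : ℕ) : ℂ) + 1) = ((2 * m + 2 : ℕ) : ℂ) + 1 by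
    push_cast; ring, Complex.Gamma_nat_eq_factorial, Complex.Gamma_nat_eq_factorial,
    Complex.Gamma_nat_eq_factorial] at h
  have hb : Complex.betaIntegral (((m + 1 : ℕ) : ℂ) + 1) (((m : ℕ) : ℂ) + 1) =
      ((∫ t in (0 : ℝ)..1, (1 - t) ^ m * t ^ (m + 1) : ℝ) : ℂ) := by
    rw [Complex.betaIntegral, ← intervalIntegral.integral_ofReal]
    refine intervalIntegral.integral_congr fun t _ => ?_
    simp only [add_sub_cancel_right, Complex.cpow_natCast]
    push_cast
    ring
  rw [hb] at h
  have h' : ((m + 1)! : ℝ) * (m ! : ℝ) =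
      ((2 * m + 2)! : ℝ) * ∫ t in (0 : ℝ)..1, (1 - t) ^ m * t ^ (m + 1) := by
    exact_mod_cast h
  have hc := Nat.choose_mul_factorial_mul_factorial (n := 2 * (m + 1)) (k := m + 1) (by omega)
  rw [show 2 * (m + 1) - (m + 1) = m + 1 by omega] at hc
  have hc' : ((2 * (m + 1)).choose (m + 1) : ℝ) * (m + 1)! * (m + 1)! = (2 * m + 2)! := by
    exact_mod_cast hc
  have hpos : 0 < ((2 * (m + 1)).choose (m + 1) : ℝ) := by
    exact_mod_cast Nat.choose_pos (by omega)
  simp only [mul_assoc, intervalIntegral.integral_const_mul, Nat.add_sub_cancel]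
  refine eq_inv_of_mul_eq_one_left ?_
  rw [← hc'] at h'
  have hf : ((m + 1)! : ℝ) = (m + 1) * m ! := by
    rw [Nat.factorial_succ]; push_cast; ring
  have hm0 : (m ! : ℝ) ≠ 0 := by positivity
  rw [hf] at h'
  push_cast
  have hm1 : (m + 1 : ℝ) ≠ 0 := by positivity
  have : ((m + 1 : ℝ) * m ! * m !) * 1 = ((m + 1 : ℝ) * m ! * m !) * ((m + 1) *
      (∫ t in (0 : ℝ)..1, (1 - t) ^ m * t ^ (m + 1)) * ((2 * (m + 1)).choose (m + 1) : ℝ)) := by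
    linear_combination h'
  exact (mul_left_cancel₀ (by positivity) this).symm

/-! ### Log-concavity of the fiber volume -/

namespace IsGauge

section Fiber

variable {n : ℕ} {M N : EuclideanSpace ℝ (Fin n) → ℝ}

local notation "𝔼" => EuclideanSpace ℝ (Fin n)

theorem volume_le (hN : IsGauge N) {t : ℝ} (ht : 0 < t) :
    volume {x | N x ≤ t} = ENNReal.ofReal (t ^ n) * volume {x | N x ≤ 1} := by
  rw [hN.setOf_le ht, Measure.addHaar_smul, finrank_euclideanSpace_fin, abs_of_pos (by positivity)]

/-- The pairs `(z, a)` with `M a + N (z - a) ≤ 1` form a convex set, so its indicator is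
log-concave, and the fiber volume is the marginal in `a`. -/
theorem isLogConcave_volume_fiber (hM : IsGauge M) (hN : IsGauge N) :
    IsLogConcave fun z : 𝔼 => volume {a | M a + N (z - a) ≤ 1} := by
  have hMc := hM.continuous
  have hNc := hN.continuous
  set S : Set (𝔼 × (Fin n → ℝ)) := {q | M (WithLp.toLp 2 q.2) + N (q.1 - WithLp.toLp 2 q.2) ≤ 1}
  have hcl : IsClosed S := isClosed_le (by fun_prop) continuous_const
  obtain ⟨c, hc, hlow⟩ := hM.lower
  have h := IsLogConcave.lintegral_pi n (V := 𝔼) (S.indicator 1) (by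
      intro x y a b ha hb hab
      by_cases hx : x ∈ S
      swap
      · simp [indicator_of_notMem hx, ENNReal.zero_rpow_of_pos ha]
      by_cases hy : y ∈ S
      swap
      · simp [indicator_of_notMem hy, ENNReal.zero_rpow_of_pos hb]
      have : a • x + b • y ∈ S := by
        simp only [S, mem_ofPred_eq, Prod.fst_add, Prod.snd_add, Prod.smul_fst,
          Prod.smul_snd, WithLp.toLp_add, WithLp.toLp_smul] at hx hy ⊢
        have h1 := hM.add_le (a • WithLp.toLp 2 x.2) (b • WithLp.toLp 2 y.2)
        have h2 := hN.add_le (a • (x.1 - WithLp.toLp 2 x.2)) (b • (y.1 - WithLp.toLp 2 y.2))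
        rw [hM.smul a ha.le, hM.smul b hb.le] at h1
        rw [hN.smul a ha.le, hN.smul b hb.le] at h2
        rw [show a • x.1 + b • y.1 - (a • WithLp.toLp 2 x.2 + b • WithLp.toLp 2 y.2) =
          a • (x.1 - WithLp.toLp 2 x.2) + b • (y.1 - WithLp.toLp 2 y.2) by module]
        nlinarith
      simp [indicator_of_mem hx, indicator_of_mem hy, indicator_of_mem this])
    (fun v => (measurable_const.indicator hcl.measurableSet).comp measurable_prodMk_left)
    ENNReal.one_ne_top (fun z => indicator_le_self' (fun _ _ => bot_le) z) (R := 1 / c) (by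
      intro v x hx
      refine indicator_of_notMem (fun hS => hx ?_) _
      simp only [S, mem_ofPred_eq] at hS
      have h1 := hlow (WithLp.toLp 2 x)
      have h2 := hN.nonneg (v - WithLp.toLp 2 x)
      rw [mem_closedBall_zero_iff, le_div_iff₀ hc, mul_comm]
      have h3 : ‖x‖ ≤ ‖(WithLp.toLp 2 x : 𝔼)‖ := by
        rw [pi_norm_le_iff_of_nonneg (norm_nonneg _)]
        exact fun i => PiLp.norm_apply_le (WithLp.toLp 2 x : 𝔼) i
      nlinarith)
  convert h using 2 with z
  have e := PiLp.volume_preserving_toLp (Fin n)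
  have hm : MeasurableSet {a | M a + N (z - a) ≤ 1} :=
    (isClosed_le (by fun_prop) continuous_const).measurableSet
  rw [← e.measure_preimage hm.nullMeasurableSet, ← lintegral_indicator_one (e.measurable hm)]
  rfl

end Fiber

end IsGauge

/-! ### Moments of the ball of `M a + N b` and the inequality for gauges -/

namespace IsGauge

section Moments

variable {n : ℕ} {M N : EuclideanSpace ℝ (Fin n) → ℝ}

local notation "𝔼" => EuclideanSpace ℝ (Fin n)

theorem volume_real_le (hn : 1 ≤ n) (hN : IsGauge N) {t : ℝ} (ht : 0 ≤ t) :
    volume.real {x | N x ≤ t} = t ^ n * volume.real {x | N x ≤ 1} := by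
  -- At `t = 0` the ball reduces to the origin, which is null because `n ≥ 1`; this level occurs for
  -- fibers over `M a = 1`.
  rcases ht.eq_or_lt with rfl | ht'
  · have h0 : {x | N x ≤ 0} ⊆ (0 : ℝ) • {x | N x ≤ 1} := by
      obtain ⟨c, hc, h⟩ := hN.lower
      intro x hx
      have : ‖x‖ ≤ 0 := nonpos_of_mul_nonpos_right ((h x).trans hx) hc
      exact ⟨0, by simp [hN.zero], by simpa using (norm_le_zero_iff.1 this).symm⟩
    have hv : volume {x | N x ≤ 0} = 0 := by
      refine measure_mono_null h0 ?_
      rw [Measure.addHaar_smul, finrank_euclideanSpace_fin, zero_pow (by omega)]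
      simp
    rw [measureReal_def, hv, zero_pow (by omega)]
    simp
  · rw [measureReal_def, hN.volume_le ht', ENNReal.toReal_mul,
      ENNReal.toReal_ofReal (by positivity), measureReal_def]

theorem setIntegral_le_of_homogeneous (hN : IsGauge N) {g : 𝔼 → ℝ} {k : ℕ}
    (hg : ∀ t : ℝ, 0 < t → ∀ x, g (t • x) = t ^ k * g x) {t : ℝ} (ht : 0 < t) :
    ∫ x in {x | N x ≤ t}, g x = t ^ (n + k) * ∫ x in {x | N x ≤ 1}, g x := by
  have h := Measure.setIntegral_comp_smul_of_pos (volume : Measure 𝔼) g {x | N x ≤ 1} ht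
  rw [← hN.setOf_le ht, finrank_euclideanSpace_fin] at h
  simp only [hg t ht] at h
  rw [integral_const_mul, smul_eq_mul, eq_inv_mul_iff_mul_eq₀ (by positivity)] at h
  rw [← h]
  ring

/-- Writing the weight as an integral over levels `t ≥ u` lets Fubini replace an integral against
`(1 - N x) ^ n` by integrals over the balls `{N ≤ t}`, which scale. -/
theorem one_sub_pow_eq_integral (hn : 1 ≤ n) {u : ℝ} (hu0 : 0 ≤ u) (hu1 : u ≤ 1) :
    (1 - u) ^ n = ∫ t in Ioc (0 : ℝ) 1, (Ici u).indicator (fun t => n * (1 - t) ^ (n - 1)) t := by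
  rw [setIntegral_indicator measurableSet_Ici]
  have h1 : ∫ t in Ioc (0 : ℝ) 1 ∩ Ici u, (n : ℝ) * (1 - t) ^ (n - 1) =
      ∫ t in u..1, (n : ℝ) * (1 - t) ^ (n - 1) := by
    rw [intervalIntegral.integral_of_le hu1]
    refine setIntegral_congr_set ?_
    refine Filter.EventuallyEq.trans
      (ae_eq_set_inter (Ioc_ae_eq_Icc (μ := volume)) Filter.EventuallyEq.rfl) ?_
    have : Icc (0 : ℝ) 1 ∩ Ici u = Icc u 1 := by
      ext t
      simp only [mem_inter_iff, mem_Icc, mem_Ici]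
      constructor
      · rintro ⟨⟨_, h⟩, h'⟩; exact ⟨h', h⟩
      · rintro ⟨h, h'⟩; exact ⟨⟨hu0.trans h, h'⟩, h⟩
    rw [this]
    exact Ioc_ae_eq_Icc.symm
  have hderiv : ∀ t ∈ uIcc u 1, HasDerivAt (fun t : ℝ => -(1 - t) ^ n)
      ((n : ℝ) * (1 - t) ^ (n - 1)) t := by
    intro t _
    have : HasDerivAt (fun t : ℝ => -(1 - t) ^ n) _ t :=
      (((hasDerivAt_id t).const_sub 1).pow n).neg
    exact this.congr_deriv (by simp)
  rw [h1, intervalIntegral.integral_eq_sub_of_hasDerivAt hderiv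
    ((by fun_prop : Continuous fun t : ℝ => (n : ℝ) * (1 - t) ^ (n - 1)).intervalIntegrable _ _)]
  simp [zero_pow (show n ≠ 0 by omega)]

/-- Integrals of homogeneous functions against powers of `1 - N`. -/
theorem setIntegral_mul_one_sub_pow (hn : 1 ≤ n) (hN : IsGauge N) {g : 𝔼 → ℝ} {k : ℕ}
    (hgc : Continuous g) (hg : ∀ t : ℝ, 0 < t → ∀ x, g (t • x) = t ^ k * g x) :
    ∫ x in {x | N x ≤ 1}, g x * (1 - N x) ^ n =
      (∫ t in (0 : ℝ)..1, n * (1 - t) ^ (n - 1) * t ^ (n + k)) * ∫ x in {x | N x ≤ 1}, g x := by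
  have hNc := hN.continuous
  set A : Set 𝔼 := {x | N x ≤ 1}
  have hA : IsCompact A := hN.isCompact_le 1
  set w : ℝ → ℝ := fun t => n * (1 - t) ^ (n - 1)
  have hw : Continuous w := by fun_prop
  have h1 : ∫ x in A, g x * (1 - N x) ^ n =
      ∫ x in A, ∫ t in Ioc (0 : ℝ) 1, {q : 𝔼 × ℝ | N q.1 ≤ q.2}.indicator
        (fun q => g q.1 * w q.2) (x, t) := by
    refine setIntegral_congr_fun hA.measurableSet fun x hx => ?_
    rw [one_sub_pow_eq_integral hn (hN.nonneg x) hx, ← integral_const_mul]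
    congr 1 with t
    by_cases h : N x ≤ t
    · rw [indicator_of_mem (show t ∈ Ici (N x) from h),
        indicator_of_mem (show (x, t) ∈ {q : 𝔼 × ℝ | N q.1 ≤ q.2} from h)]
    · rw [indicator_of_notMem (show t ∉ Ici (N x) from h),
        indicator_of_notMem (show (x, t) ∉ {q : 𝔼 × ℝ | N q.1 ≤ q.2} from h), mul_zero]
  have hint : Integrable (Function.uncurry fun (x : 𝔼) (t : ℝ) =>
      {q : 𝔼 × ℝ | N q.1 ≤ q.2}.indicator (fun q => g q.1 * w q.2) (x, t))
      ((volume.restrict A).prod (volume.restrict (Ioc (0 : ℝ) 1))) := by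
    rw [Measure.prod_restrict]
    refine Integrable.indicator (f := fun q : 𝔼 × ℝ => g q.1 * w q.2) ?_
      (isClosed_le (by fun_prop) continuous_snd).measurableSet
    refine IntegrableOn.mono_set (t := A ×ˢ Icc 0 1) ?_ (prod_mono le_rfl Ioc_subset_Icc_self)
    exact (by fun_prop : Continuous fun q : 𝔼 × ℝ => g q.1 * w q.2).continuousOn.integrableOn_compact
      (hA.prod isCompact_Icc)
  rw [h1, integral_integral_swap hint, intervalIntegral.integral_of_le zero_le_one,
    ← integral_mul_const]
  refine setIntegral_congr_fun measurableSet_Ioc fun t ht => ?_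
  have hsub : {x | N x ≤ t} ⊆ A := fun x (hx : N x ≤ t) => hx.trans ht.2
  have hmeas : MeasurableSet {x | N x ≤ t} := (hN.isCompact_le t).measurableSet
  have h2 : ∀ x, {q : 𝔼 × ℝ | N q.1 ≤ q.2}.indicator (fun q => g q.1 * w q.2) (x, t) =
      {x | N x ≤ t}.indicator (fun x => g x * w t) x := fun x => rfl
  simp only [h2]
  rw [setIntegral_indicator hmeas, inter_eq_self_of_subset_right hsub, integral_mul_const,
    hN.setIntegral_le_of_homogeneous hg ht.1]
  ring

/-- Integrals over the unit ball of `(a, b) ↦ M a + N b` of functions of the first variable. -/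
theorem setIntegral_fst (hn : 1 ≤ n) (hM : IsGauge M) (hN : IsGauge N) {g : 𝔼 → ℝ} {k : ℕ}
    (hgc : Continuous g) (hg : ∀ t : ℝ, 0 < t → ∀ x, g (t • x) = t ^ k * g x) :
    ∫ q in {q : 𝔼 × 𝔼 | M q.1 + N q.2 ≤ 1}, g q.1 =
      (∫ t in (0 : ℝ)..1, n * (1 - t) ^ (n - 1) * t ^ (n + k)) *
        (∫ x in {x | M x ≤ 1}, g x) * volume.real {x | N x ≤ 1} := by
  have hMc := hM.continuous
  have hNc := hN.continuous
  set T := {q : 𝔼 × 𝔼 | M q.1 + N q.2 ≤ 1}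
  have hT : IsCompact T := hM.isCompact_add_le hN
  -- The fiber over `a` is the ball `{N ≤ 1 - M a}`, of volume `(1 - M a) ^ n` times that of the
  -- unit ball.
  rw [← hM.setIntegral_mul_one_sub_pow hn hgc hg, ← integral_mul_const,
    ← integral_indicator hT.measurableSet, ← integral_indicator (hM.isCompact_le 1).measurableSet,
    Measure.volume_eq_prod, integral_prod]
  · congr 1 with a
    have h1 : ∀ b, T.indicator (fun q => g q.1) (a, b) =
        {b | M a + N b ≤ 1}.indicator (fun _ => g a) b := fun b => rfl
    simp only [h1]
    have hm : MeasurableSet {b | M a + N b ≤ 1} :=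
      (isClosed_le (by fun_prop) continuous_const).measurableSet
    rw [integral_indicator hm, setIntegral_const, smul_eq_mul]
    by_cases ha : M a ≤ 1
    · rw [indicator_of_mem (show a ∈ {x | M x ≤ 1} from ha)]
      have : {b | M a + N b ≤ 1} = {b | N b ≤ 1 - M a} := by
        ext b
        simp only [mem_ofPred_eq]
        constructor <;> intro h <;> linarith
      rw [this, hN.volume_real_le hn (by linarith)]
      ring
    · rw [indicator_of_notMem (show a ∉ {x | M x ≤ 1} from ha)]
      have : {b | M a + N b ≤ 1} = ∅ := by
        ext b
        simp only [mem_ofPred_eq, mem_empty_iff_false, iff_false]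
        have := hN.nonneg b
        linarith
      simp [this]
  · rw [← Measure.volume_eq_prod, integrable_indicator_iff hT.measurableSet]
    exact (hgc.comp continuous_fst).continuousOn.integrableOn_compact hT

/-- Swapping the coordinates reduces this to `setIntegral_fst`. The beta factor is the same for
both, so first moments with opposite barycenters can cancel. -/
theorem setIntegral_snd (hn : 1 ≤ n) (hM : IsGauge M) (hN : IsGauge N) {g : 𝔼 → ℝ} {k : ℕ}
    (hgc : Continuous g) (hg : ∀ t : ℝ, 0 < t → ∀ x, g (t • x) = t ^ k * g x) :
    ∫ q in {q : 𝔼 × 𝔼 | M q.1 + N q.2 ≤ 1}, g q.2 =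
      (∫ t in (0 : ℝ)..1, n * (1 - t) ^ (n - 1) * t ^ (n + k)) *
        (∫ x in {x | N x ≤ 1}, g x) * volume.real {x | M x ≤ 1} := by
  rw [← hN.setIntegral_fst hn hM hgc hg]
  have e := (Measure.measurePreserving_swap (μ := (volume : Measure 𝔼)) (ν := (volume : Measure 𝔼)))
  have := e.setIntegral_preimage_emb MeasurableEquiv.prodComm.measurableEmbedding
    (fun q : 𝔼 × 𝔼 => g q.1) {q : 𝔼 × 𝔼 | N q.1 + M q.2 ≤ 1}
  rw [Measure.volume_eq_prod, ← this]
  have hs : Prod.swap ⁻¹' {q : 𝔼 × 𝔼 | N q.1 + M q.2 ≤ 1} =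
      {q : 𝔼 × 𝔼 | M q.1 + N q.2 ≤ 1} := by
    ext q
    simp [add_comm]
  rw [hs]
  rfl

/-- Volume of the unit ball of `(a, b) ↦ M a + N b` corrected by a linear functional, in case the
two unit balls have opposite barycenters. -/
theorem setIntegral_one_sub_linear (hn : 1 ≤ n) (hM : IsGauge M) (hN : IsGauge N)
    (hbar : barycenter {x | M x ≤ 1} = -barycenter {x | N x ≤ 1}) (l : 𝔼 →L[ℝ] ℝ) :
    ∫ q in {q : 𝔼 × 𝔼 | M q.1 + N q.2 ≤ 1}, (1 - l (q.1 + q.2)) =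
      ((2 * n).choose n : ℝ)⁻¹ * (volume.real {x | M x ≤ 1} * volume.real {x | N x ≤ 1}) := by
  set T := {q : 𝔼 × 𝔼 | M q.1 + N q.2 ≤ 1}
  have hT : IsCompact T := hM.isCompact_add_le hN
  have int : ∀ g : 𝔼 × 𝔼 → ℝ, Continuous g → IntegrableOn g T := fun g hg =>
    hg.continuousOn.integrableOn_compact hT
  have hl : ∀ t : ℝ, 0 < t → ∀ x, l (t • x) = t ^ 1 * l x := fun t _ x => by simp
  have hlin : ∀ {N : 𝔼 → ℝ}, IsGauge N → ∫ x in {x | N x ≤ 1}, l x =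
      volume.real {x | N x ≤ 1} * l (barycenter {x | N x ≤ 1}) := by
    intro N hN
    have hid : IntegrableOn (fun x : 𝔼 => x) {x | N x ≤ 1} :=
      continuous_id.continuousOn.integrableOn_compact (hN.isCompact_le 1)
    rw [l.integral_comp_comm hid,
      barycenter, setAverage_eq, map_smul, smul_eq_mul]
    -- For a null ball the average takes the default value `0`, and both sides vanish.
    rcases eq_or_ne (volume.real {x | N x ≤ 1}) 0 with h0 | h0
    · have hv : volume {x | N x ≤ 1} = 0 := by
        rwa [measureReal_eq_zero_iff (hN.isCompact_le 1).measure_lt_top.ne] at h0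
      rw [Measure.restrict_eq_zero.2 hv]
      simp
    · rw [mul_inv_cancel_left₀ h0]
  -- Degree `0` produces the volume and the binomial coefficient. In degree `1` the two terms share
  -- a factor times `l (bar A) + l (bar B)`, which is zero.
  have h0 := hM.setIntegral_fst hn hN (g := fun _ => 1) (k := 0) continuous_const (by simp)
  have h1 := hM.setIntegral_fst hn hN (g := l) (k := 1) l.continuous hl
  have h2 := hM.setIntegral_snd hn hN (g := l) (k := 1) l.continuous hl
  rw [hlin hM] at h1
  rw [hlin hN] at h2
  have hA : ∫ x in {x | M x ≤ 1}, (1 : ℝ) = volume.real {x | M x ≤ 1} := by simp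
  rw [add_zero, integral_mul_one_sub_pow_mul_pow hn, hA] at h0
  have hbl : l (barycenter {x | M x ≤ 1}) = -l (barycenter {x | N x ≤ 1}) := by
    rw [hbar, map_neg]
  simp only [map_add]
  rw [integral_sub (int _ continuous_const) (int _ (by fun_prop)),
    integral_add (int _ (by fun_prop)) (int _ (by fun_prop)), h0, h1, h2, hbl]
  ring

/-- Bound for the volume of the unit ball of `(a, b) ↦ M a + N b` corrected by a linear functional,
by fibering along the map `(a, b) ↦ a + b`. -/
theorem setIntegral_one_sub_linear_le (hM : IsGauge M) (hN : IsGauge N) (l : 𝔼 →L[ℝ] ℝ)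
    (hl : ∀ z, volume.real {a | M a + N (z - a) ≤ 1} ≤
      volume.real {a | M a + N (-a) ≤ 1} * Real.exp (l z)) :
    ∫ q in {q : 𝔼 × 𝔼 | M q.1 + N q.2 ≤ 1}, (1 - l (q.1 + q.2)) ≤
      volume.real {a | M a + N (-a) ≤ 1} *
        volume.real (convexHull ℝ ({x | M x ≤ 1} ∪ {x | N x ≤ 1})) := by
  have hMc := hM.continuous
  have hNc := hN.continuous
  set T := {q : 𝔼 × 𝔼 | M q.1 + N q.2 ≤ 1}
  have hT : IsCompact T := hM.isCompact_add_le hN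
  set S := {q : 𝔼 × 𝔼 | M q.1 + N (q.2 - q.1) ≤ 1}
  have hS : IsCompact S := hM.isCompact_add_sub_le hN
  set C := convexHull ℝ ({x | M x ≤ 1} ∪ {x | N x ≤ 1})
  have hCfin : volume C ≠ ∞ :=
    (isBounded_convexHull.2
      ((hM.isCompact_le 1).union (hN.isCompact_le 1)).isBounded).measure_lt_top.ne
  have hint : Integrable (S.indicator fun q => 1 - l q.2)
      ((volume : Measure 𝔼).prod (volume : Measure 𝔼)) := by
    rw [← Measure.volume_eq_prod, integrable_indicator_iff hS.measurableSet]
    exact (by fun_prop : Continuous fun q : 𝔼 × 𝔼 => 1 - l q.2).continuousOn.integrableOn_compact hS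
  have h3 : ∀ z : 𝔼, ∫ a, S.indicator (fun q => 1 - l q.2) (a, z) =
      volume.real {a | M a + N (z - a) ≤ 1} * (1 - l z) := by
    intro z
    have h3 : ∀ a : 𝔼, S.indicator (fun q => 1 - l q.2) (a, z) =
        {a | M a + N (z - a) ≤ 1}.indicator (fun _ => 1 - l z) a := fun a => rfl
    simp only [h3]
    rw [integral_indicator (isClosed_le (by fun_prop) continuous_const).measurableSet,
      setIntegral_const, smul_eq_mul]
  -- Translation by `a` in the inner integral substitutes `z = a + b`; Fubini then integrates over
  -- `a` first.
  have h1 : ∫ q in T, (1 - l (q.1 + q.2)) =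
      ∫ z, volume.real {a | M a + N (z - a) ≤ 1} * (1 - l z) := by
    rw [← integral_indicator hT.measurableSet, Measure.volume_eq_prod, integral_prod]
    · have h2 : ∀ a : 𝔼, ∫ b, T.indicator (fun q => 1 - l (q.1 + q.2)) (a, b) =
          ∫ z, S.indicator (fun q => 1 - l q.2) (a, z) := by
        intro a
        rw [← integral_add_left_eq_self (fun z => S.indicator (fun q => 1 - l q.2) (a, z)) a]
        congr 1 with b
        simp only [indicator, T, S, mem_ofPred_eq, add_sub_cancel_left]
      simp only [h2]
      rw [integral_integral_swap
        (f := fun a z => S.indicator (fun q : 𝔼 × 𝔼 => 1 - l q.2) (a, z)) hint]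
      simp only [h3]
    · rw [← Measure.volume_eq_prod, integrable_indicator_iff hT.measurableSet]
      exact (by fun_prop : Continuous fun q : 𝔼 × 𝔼 =>
        1 - l (q.1 + q.2)).continuousOn.integrableOn_compact hT
  rw [h1]
  set m := volume.real {a | M a + N (-a) ≤ 1}
  have hm0 : 0 ≤ m := measureReal_nonneg
  -- Where `1 - l z` is positive, `1 - l z ≤ exp (-l z)` cancels the majorant of the fiber volume;
  -- elsewhere the left side is nonpositive. Off `C` the fiber is empty. A measurable hull of `C`
  -- avoids proving `C` measurable.
  have hbound : ∀ z, volume.real {a | M a + N (z - a) ≤ 1} * (1 - l z) ≤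
      (toMeasurable volume C).indicator (fun _ => m) z := by
    intro z
    by_cases hz : z ∈ C
    · rw [indicator_of_mem (subset_toMeasurable _ _ hz)]
      have hv : 0 ≤ volume.real {a | M a + N (z - a) ≤ 1} := measureReal_nonneg
      rcases le_or_gt (1 - l z) 0 with h | h
      · exact (mul_nonpos_of_nonneg_of_nonpos hv h).trans hm0
      · have hexp : 1 - l z ≤ Real.exp (-l z) := by
          have := Real.add_one_le_exp (-l z)
          linarith
        calc _ ≤ (m * Real.exp (l z)) * Real.exp (-l z) := by
              gcongr
              exact hl z
          _ = m := by rw [mul_assoc, ← Real.exp_add]; simp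
    · have : {a | M a + N (z - a) ≤ 1} = ∅ := by
        ext a
        simp only [mem_ofPred_eq, mem_empty_iff_false, iff_false]
        intro h
        refine hz ?_
        simpa using hM.add_mem_convexHull hN h
      rw [this, measureReal_empty, zero_mul]
      exact indicator_nonneg (fun _ _ => hm0) z
  have hCm := measurableSet_toMeasurable (volume : Measure 𝔼) C
  calc _ ≤ ∫ z, (toMeasurable volume C).indicator (fun _ => m) z := by
        refine integral_mono ?_ ?_ hbound
        · simpa only [h3] using hint.integral_prod_right
        · rw [integrable_indicator_iff hCm]
          exact integrableOn_const (by rwa [measure_toMeasurable])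
    _ = m * volume.real C := by
        rw [integral_indicator hCm, setIntegral_const, smul_eq_mul, measureReal_def,
          measure_toMeasurable, mul_comm, measureReal_def]

/-- A Rogers–Shephard type inequality for two gauges whose unit balls have opposite barycenters. -/
theorem volume_mul_volume_le (hn : 1 ≤ n) (hM : IsGauge M) (hN : IsGauge N)
    (hbar : barycenter {x | M x ≤ 1} = -barycenter {x | N x ≤ 1}) :
    volume {x | M x ≤ 1} * volume {x | N x ≤ 1} ≤ ((2 * n).choose n : ℝ≥0∞) *
      volume (convexHull ℝ ({x | M x ≤ 1} ∪ {x | N x ≤ 1})) *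
        volume {a | M a + N (-a) ≤ 1} := by
  have hMc := hM.continuous
  have hNc := hN.continuous
  have hfin : ∀ z, volume {a | M a + N (z - a) ≤ 1} ≠ ∞ := by
    intro z
    refine ne_top_of_le_ne_top (hM.isCompact_le 1).measure_lt_top.ne (measure_mono fun a ha => ?_)
    have := hN.nonneg (z - a)
    simp only [mem_ofPred_eq] at ha ⊢
    linarith
  -- By continuity at the origin, fibers over small `z` contain a ball, so `0` is interior to the
  -- support of the fiber volume.
  obtain ⟨r, hr, hball⟩ : ∃ r > 0, ∀ q ∈ Metric.ball (0 : 𝔼 × 𝔼) r, M q.2 + N (q.1 - q.2) < 1 := by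
    have ho : IsOpen {q : 𝔼 × 𝔼 | M q.2 + N (q.1 - q.2) < 1} :=
      isOpen_lt (by fun_prop) continuous_const
    exact Metric.isOpen_iff.1 ho 0 (by simp [hM.zero, hN.zero])
  obtain ⟨l, hl⟩ := (hM.isLogConcave_volume_fiber hN).exists_le_mul_exp hfin hr (by
    intro z hz
    refine ((Metric.measure_ball_pos volume (0 : 𝔼) hr).trans_le (measure_mono fun a ha => ?_)).ne'
    refine (hball (z, a) ?_).le
    rw [← Prod.mk_zero_zero, ← ball_prod_same]
    exact ⟨hz, ha⟩)
  simp only [zero_sub] at hl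
  have h1 := hM.setIntegral_one_sub_linear_le hN l hl
  rw [hM.setIntegral_one_sub_linear hn hN hbar l] at h1
  have hch : (0 : ℝ) < (2 * n).choose n := by exact_mod_cast Nat.choose_pos (by omega)
  rw [inv_mul_le_iff₀ hch] at h1
  have hCfin : volume (convexHull ℝ ({x | M x ≤ 1} ∪ {x | N x ≤ 1})) ≠ ∞ :=
    (isBounded_convexHull.2
      ((hM.isCompact_le 1).union (hN.isCompact_le 1)).isBounded).measure_lt_top.ne
  have h0 : volume {a | M a + N (-a) ≤ 1} ≠ ∞ := by simpa using hfin 0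
  rw [← ENNReal.toReal_le_toReal
    (ENNReal.mul_ne_top (hM.isCompact_le 1).measure_lt_top.ne (hN.isCompact_le 1).measure_lt_top.ne)
    (ENNReal.mul_ne_top (ENNReal.mul_ne_top (ENNReal.natCast_ne_top _) hCfin) h0),
    ENNReal.toReal_mul, ENNReal.toReal_mul, ENNReal.toReal_mul, ENNReal.toReal_natCast]
  simp only [measureReal_def] at h1
  linarith

/-- The unit ball of `a ↦ M a + N (-a)` is contained in the polar of the difference of polars. -/
theorem subset_polarBody_sub (hM : IsGauge M) (hN : IsGauge N) :
    {a | M a + N (-a) ≤ 1} ⊆ polarBody (polarBody {x | M x ≤ 1} - polarBody {x | N x ≤ 1}) := by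
  -- Homogeneity upgrades the polar condition on the unit ball to `⟪y, x⟫ ≤ N x` for every `x`.
  have key : ∀ {N : 𝔼 → ℝ}, IsGauge N → ∀ y ∈ polarBody {x | N x ≤ 1}, ∀ x, inner ℝ y x ≤ N x := by
    intro N hN y hy x
    rcases (hN.nonneg x).eq_or_lt with h0 | h0
    · obtain ⟨c, hc, h⟩ := hN.lower
      have : ‖x‖ ≤ 0 := nonpos_of_mul_nonpos_right ((h x).trans h0.symm.le) hc
      rw [norm_le_zero_iff.1 this, hN.zero, inner_zero_right]
    · have h1 : N ((N x)⁻¹ • x) ≤ 1 := by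
        rw [hN.smul _ (inv_nonneg.2 h0.le), inv_mul_cancel₀ h0.ne']
      have h2 := hy _ h1
      rwa [inner_smul_right, inv_mul_le_iff₀ h0, mul_one] at h2
  rintro a ha _ ⟨x, hx, y, hy, rfl⟩
  have h1 := key hM x hx a
  have h2 := key hN y hy (-a)
  simp only [mem_ofPred_eq] at ha
  rw [inner_neg_right] at h2
  rw [inner_sub_right, real_inner_comm, real_inner_comm y]
  linarith

end Moments

end IsGauge

/-! ### Ball's integral inequality -/

theorem hasStrictDerivAt_integral_zero {f : ℝ → ℝ} (hf : Continuous f) (r : ℝ) :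
    HasStrictDerivAt (fun u => ∫ x in (0 : ℝ)..u, f x) (f r) r :=
  intervalIntegral.integral_hasStrictDerivAt_right (hf.intervalIntegrable _ _)
    (hf.stronglyMeasurableAtFilter _ _) hf.continuousAt

/-- The inverse of the primitive of a positive integrable function on `(0, ∞)`. -/
theorem exists_inverse_of_primitive {f : ℝ → ℝ} (hf : Continuous f) (hpos : ∀ r > 0, 0 < f r)
    (hint : IntegrableOn f (Ioi 0)) :
    ∃ T : ℝ → ℝ, StrictMonoOn T (Ioo 0 (∫ r in Ioi 0, f r)) ∧
      ∀ y ∈ Ioo 0 (∫ r in Ioi 0, f r), 0 < T y ∧ HasDerivAt T (f (T y))⁻¹ y := by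
  set α := ∫ r in Ioi 0, f r
  set Φ : ℝ → ℝ := fun u => ∫ x in (0 : ℝ)..u, f x
  have hΦd : ∀ r, HasDerivAt Φ (f r) r := fun r => (hasStrictDerivAt_integral_zero hf r).hasDerivAt
  have hΦc : Continuous Φ := continuous_iff_continuousAt.2 fun r => (hΦd r).continuousAt
  have hΦm : StrictMonoOn Φ (Ici 0) := by
    refine strictMonoOn_of_deriv_pos (convex_Ici 0) hΦc.continuousOn fun r hr => ?_
    rw [interior_Ici] at hr
    rw [(hΦd r).deriv]
    exact hpos r hr
  have hΦ0 : Φ 0 = 0 := intervalIntegral.integral_same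
  have hlim : Filter.Tendsto Φ Filter.atTop (nhds α) :=
    intervalIntegral_tendsto_integral_Ioi 0 hint Filter.tendsto_id
  have hlt : ∀ r, 0 ≤ r → Φ r < α := by
    intro r hr
    have h1 : Φ r < Φ (r + 1) := hΦm hr (by simp only [mem_Ici]; linarith) (by linarith)
    refine h1.trans_le (ge_of_tendsto hlim ?_)
    filter_upwards [Filter.eventually_ge_atTop (r + 1)] with u hu
    exact hΦm.monotoneOn (by simp only [mem_Ici]; linarith) (by simp only [mem_Ici]; linarith) hu
  have hex : ∀ y, ∃ r, y ∈ Ioo 0 α → 0 < r ∧ Φ r = y := by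
    intro y
    by_cases hy : y ∈ Ioo 0 α
    · obtain ⟨u, hu0, hu⟩ := ((Filter.eventually_ge_atTop (0 : ℝ)).and
        (hlim.eventually (lt_mem_nhds hy.2))).exists
      obtain ⟨r, hr, hry⟩ := intermediate_value_Icc hu0 hΦc.continuousOn
        (show y ∈ Icc (Φ 0) (Φ u) from ⟨by rw [hΦ0]; exact hy.1.le, hu.le⟩)
      refine ⟨r, fun _ => ⟨lt_of_le_of_ne hr.1 ?_, hry⟩⟩
      rintro rfl
      rw [hΦ0] at hry
      exact hy.1.ne hry
    · exact ⟨0, fun h => absurd h hy⟩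
  choose T hT using hex
  have hTm : StrictMonoOn T (Ioo 0 α) := by
    intro y hy z hz hyz
    by_contra! h
    have := hΦm.monotoneOn (hT z hz).1.le (hT y hy).1.le h
    rw [(hT y hy).2, (hT z hz).2] at this
    linarith
  refine ⟨T, hTm, fun y hy => ⟨(hT y hy).1, ?_⟩⟩
  -- A strictly monotone function whose image is a neighborhood of `T y` is continuous at `y`, which
  -- is what the inverse function rule needs.
  have himg : T '' Ioo 0 α ∈ nhds (T y) := by
    filter_upwards [Ioi_mem_nhds (hT y hy).1] with r hr
    replace hr : 0 < r := hr
    have hr' : Φ r ∈ Ioo 0 α :=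
      ⟨by rw [← hΦ0]; exact hΦm (by simp) (mem_Ici.2 hr.le) hr, hlt r hr.le⟩
    exact ⟨Φ r, hr', hΦm.injOn (hT _ hr').1.le (mem_Ici.2 hr.le) (hT _ hr').2⟩
  refine HasDerivAt.of_local_left_inverse
    (hTm.continuousAt_of_image_mem_nhds (Ioo_mem_nhds hy.1 hy.2) himg) (hΦd _)
    (hpos _ (hT y hy).1).ne' ?_
  filter_upwards [Ioo_mem_nhds hy.1 hy.2] with z hz using (hT z hz).2

/-- This is the pointwise estimate in the transport proof of Ball's inequality. With `μ = s / (r +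
s)` and `ν = r / (r + s)`, the first factor times `(r s / (r + s)) ^ m` is a `(μ, ν)`-weighted
arithmetic mean. Passing to the geometric mean cancels `u ^ μ * v ^ ν` and leaves `((μ / x) ^ μ * (ν
/ y) ^ ν) ^ (m + 1)`. A second mean inequality, for `x / μ` and `y / ν` with weighted mean `x + y`,
finishes. -/
theorem inv_add_pow_le_of_harmonic {m : ℕ} {r s u v x y : ℝ} (hr : 0 < r) (hs : 0 < s)
    (hu : 0 < u) (hv : 0 < v) (hx : 0 < x) (hy : 0 < y) :
    ((x + y) ^ (m + 1))⁻¹ ≤ (((x ^ (m + 1))⁻¹ * (r ^ m * u)⁻¹ * s ^ 2 +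
      (y ^ (m + 1))⁻¹ * (s ^ m * v)⁻¹ * r ^ 2) / (r + s) ^ 2) *
      ((r * s / (r + s)) ^ m * (u ^ (s / (r + s)) * v ^ (r / (r + s)))) := by
  set μ := s / (r + s) with hμ
  set ν := r / (r + s) with hν
  have hμ0 : 0 < μ := by positivity
  have hν0 : 0 < ν := by positivity
  have hsum : μ + ν = 1 := by rw [hμ, hν]; field_simp; ring
  have hX : 0 < (μ / x) ^ (m + 1) / u := by positivity
  have hY : 0 < (ν / y) ^ (m + 1) / v := by positivity
  have h1 := Real.geom_mean_le_arith_mean2_weighted hμ0.le hν0.le hX.le hY.le hsum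
  have h2 := Real.geom_mean_le_arith_mean2_weighted hμ0.le hν0.le (div_pos hx hμ0).le
    (div_pos hy hν0).le hsum
  have h2' : μ * (x / μ) + ν * (y / ν) = x + y := by field_simp
  rw [h2'] at h2
  have h3 : ((x / μ) ^ μ * (y / ν) ^ ν)⁻¹ = (μ / x) ^ μ * (ν / y) ^ ν := by
    rw [mul_inv, ← Real.inv_rpow (by positivity), ← Real.inv_rpow (by positivity), inv_div, inv_div]
  have h4 : (x + y)⁻¹ ≤ (μ / x) ^ μ * (ν / y) ^ ν := by
    rw [← h3]
    exact inv_anti₀ (by positivity) h2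
  have h5 : (((μ / x) ^ (m + 1) / u) ^ μ * ((ν / y) ^ (m + 1) / v) ^ ν) * (u ^ μ * v ^ ν) =
      ((μ / x) ^ μ * (ν / y) ^ ν) ^ (m + 1) := by
    rw [Real.div_rpow (by positivity) hu.le, Real.div_rpow (by positivity) hv.le, mul_pow,
      ← Real.rpow_natCast ((μ / x) ^ μ), ← Real.rpow_natCast ((ν / y) ^ ν),
      ← Real.rpow_natCast (μ / x), ← Real.rpow_natCast (ν / y), ← Real.rpow_mul (by positivity),
      ← Real.rpow_mul (by positivity), ← Real.rpow_mul (by positivity),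
      ← Real.rpow_mul (by positivity), mul_comm μ, mul_comm ν]
    have : u ^ μ ≠ 0 := (Real.rpow_pos_of_pos hu _).ne'
    have : v ^ ν ≠ 0 := (Real.rpow_pos_of_pos hv _).ne'
    field_simp
  have h6 : (((x ^ (m + 1))⁻¹ * (r ^ m * u)⁻¹ * s ^ 2 +
      (y ^ (m + 1))⁻¹ * (s ^ m * v)⁻¹ * r ^ 2) / (r + s) ^ 2) * (r * s / (r + s)) ^ m =
      μ * ((μ / x) ^ (m + 1) / u) + ν * ((ν / y) ^ (m + 1) / v) := by
    rw [hμ, hν]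
    simp only [div_pow, mul_pow, pow_succ]
    field_simp
  rw [← mul_assoc, h6, inv_pow (x + y) (m + 1) |>.symm]
  calc ((x + y)⁻¹) ^ (m + 1) ≤ ((μ / x) ^ μ * (ν / y) ^ ν) ^ (m + 1) := by gcongr
    _ = _ := h5.symm
    _ ≤ _ := by gcongr

/-- Ball's integral inequality for functions related by harmonic means. -/
theorem ofReal_inv_add_pow_le_lintegral {m : ℕ} {F G H : ℝ → ℝ} (hF : Continuous F)
    (hG : Continuous G) (hF0 : ∀ r, 0 < F r) (hG0 : ∀ r, 0 < G r) {x y : ℝ} (hx : 0 < x)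
    (hy : 0 < y) (hFi : IntegrableOn (fun r => r ^ m * F r) (Ioi 0))
    (hGi : IntegrableOn (fun r => r ^ m * G r) (Ioi 0))
    (hFx : ∫ r in Ioi 0, r ^ m * F r = (x ^ (m + 1))⁻¹)
    (hGy : ∫ r in Ioi 0, r ^ m * G r = (y ^ (m + 1))⁻¹)
    (h : ∀ r s : ℝ, 0 < r → 0 < s →
      F r ^ (s / (r + s)) * G s ^ (r / (r + s)) ≤ H (r * s / (r + s))) :
    ENNReal.ofReal ((x + y) ^ (m + 1))⁻¹ ≤ ∫⁻ t in Ioi (0 : ℝ), ENNReal.ofReal (t ^ m * H t) := by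
  obtain ⟨R, hRm, hR⟩ := exists_inverse_of_primitive (f := fun r => r ^ m * F r) (by fun_prop)
    (fun r hr => mul_pos (pow_pos hr _) (hF0 r)) hFi
  obtain ⟨S, hSm, hS⟩ := exists_inverse_of_primitive (f := fun r => r ^ m * G r) (by fun_prop)
    (fun r hr => mul_pos (pow_pos hr _) (hG0 r)) hGi
  rw [hFx] at hRm hR
  rw [hGy] at hSm hS
  set α := (x ^ (m + 1))⁻¹
  set β := (y ^ (m + 1))⁻¹
  have hα : 0 < α := by positivity
  have hβ : 0 < β := by positivity
  -- `r τ` and `s τ` are the points below which a fraction `τ` of the mass of `r ^ m * F` and of `r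
  -- ^ m * G` lies; `H` is integrated along their harmonic combination `t τ`.
  set r : ℝ → ℝ := fun τ => R (α * τ)
  set s : ℝ → ℝ := fun τ => S (β * τ)
  have mem : ∀ {c : ℝ}, 0 < c → ∀ τ ∈ Ioo (0 : ℝ) 1, c * τ ∈ Ioo 0 c := fun hc τ hτ =>
    ⟨mul_pos hc hτ.1, mul_lt_of_lt_one_right hc hτ.2⟩
  have hr0 : ∀ τ ∈ Ioo (0 : ℝ) 1, 0 < r τ := fun τ hτ => (hR _ (mem hα τ hτ)).1
  have hs0 : ∀ τ ∈ Ioo (0 : ℝ) 1, 0 < s τ := fun τ hτ => (hS _ (mem hβ τ hτ)).1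
  have hrd : ∀ τ ∈ Ioo (0 : ℝ) 1, HasDerivAt r (α * (r τ ^ m * F (r τ))⁻¹) τ := by
    intro τ hτ
    have h1 := (hR _ (mem hα τ hτ)).2
    have h2 : HasDerivAt (fun τ => α * τ) α τ := by simpa using (hasDerivAt_id τ).const_mul α
    rw [mul_comm]
    exact h1.comp τ h2
  have hsd : ∀ τ ∈ Ioo (0 : ℝ) 1, HasDerivAt s (β * (s τ ^ m * G (s τ))⁻¹) τ := by
    intro τ hτ
    have h1 := (hS _ (mem hβ τ hτ)).2
    have h2 : HasDerivAt (fun τ => β * τ) β τ := by simpa using (hasDerivAt_id τ).const_mul β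
    rw [mul_comm]
    exact h1.comp τ h2
  set t : ℝ → ℝ := fun τ => r τ * s τ / (r τ + s τ)
  set t' : ℝ → ℝ := fun τ => (α * (r τ ^ m * F (r τ))⁻¹ * s τ ^ 2 +
    β * (s τ ^ m * G (s τ))⁻¹ * r τ ^ 2) / (r τ + s τ) ^ 2
  have ht0 : ∀ τ ∈ Ioo (0 : ℝ) 1, 0 < t τ := fun τ hτ => by
    have := hr0 τ hτ
    have := hs0 τ hτ
    positivity
  have ht'0 : ∀ τ ∈ Ioo (0 : ℝ) 1, 0 < t' τ := fun τ hτ => by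
    have := hr0 τ hτ
    have := hs0 τ hτ
    have := hF0 (r τ)
    have := hG0 (s τ)
    positivity
  have htd : ∀ τ ∈ Ioo (0 : ℝ) 1, HasDerivAt t (t' τ) τ := by
    intro τ hτ
    have h1 := hr0 τ hτ
    have h2 := hs0 τ hτ
    refine (((hrd τ hτ).mul (hsd τ hτ)).div ((hrd τ hτ).add (hsd τ hτ))
      (by simp only [Pi.add_apply]; positivity)).congr_deriv ?_
    simp only [t', Pi.add_apply, Pi.mul_apply]
    congr 1
    ring
  have hinj : InjOn t (Ioo 0 1) := by
    refine (strictMonoOn_of_deriv_pos (convex_Ioo 0 1)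
      (fun τ hτ => (htd τ hτ).continuousAt.continuousWithinAt) fun τ hτ => ?_).injOn
    rw [interior_Ioo] at hτ
    rw [(htd τ hτ).deriv]
    exact ht'0 τ hτ
  have hsub : t '' Ioo 0 1 ⊆ Ioi 0 := by
    rintro _ ⟨τ, hτ, rfl⟩
    exact ht0 τ hτ
  calc ENNReal.ofReal ((x + y) ^ (m + 1))⁻¹
      = ∫⁻ _ in Ioo (0 : ℝ) 1, ENNReal.ofReal ((x + y) ^ (m + 1))⁻¹ := by simp
    _ ≤ ∫⁻ τ in Ioo (0 : ℝ) 1, ENNReal.ofReal |t' τ| * ENNReal.ofReal (t τ ^ m * H (t τ)) := by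
        refine setLIntegral_mono' measurableSet_Ioo fun τ hτ => ?_
        rw [← ENNReal.ofReal_mul (abs_nonneg _), abs_of_pos (ht'0 τ hτ)]
        refine ENNReal.ofReal_le_ofReal ?_
        refine (inv_add_pow_le_of_harmonic (m := m) (hr0 τ hτ) (hs0 τ hτ) (hF0 (r τ)) (hG0 (s τ))
          hx hy).trans ?_
        have h1 := ht0 τ hτ
        have h2 := ht'0 τ hτ
        exact mul_le_mul_of_nonneg_left
          (mul_le_mul_of_nonneg_left (h _ _ (hr0 τ hτ) (hs0 τ hτ)) (pow_pos h1 m).le) h2.le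
    _ = ∫⁻ t in t '' Ioo 0 1, ENNReal.ofReal (t ^ m * H t) :=
        (lintegral_image_eq_lintegral_abs_deriv_mul measurableSet_Ioo
          (fun τ hτ => (htd τ hτ).hasDerivWithinAt) hinj
          fun t => ENNReal.ofReal (t ^ m * H t)).symm
    _ ≤ _ := lintegral_mono_set hsub

/-! ### Ball's gauge of a coercive convex function -/

/-- The functional `y ↦ ((1 / (n-1)!) ∫_0^∞ r^{n-1} e^{-h(r y)} dr)^{-1/n}`. -/
noncomputable def ballNorm {E : Type*} [AddCommGroup E] [Module ℝ E] (n : ℕ) (h : E → ℝ) (y : E) : ℝ≥0∞ :=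
  (((n - 1)! : ℝ≥0∞)⁻¹ *
    ∫⁻ r in Ioi (0 : ℝ), ENNReal.ofReal (r ^ (n - 1) * Real.exp (-h (r • y)))) ^ (-(1 / (n : ℝ)))

section BallNorm

variable {E : Type*} [NormedAddCommGroup E] [NormedSpace ℝ E]

theorem ballNorm_zero {n : ℕ} (hn : 1 ≤ n) (h : E → ℝ) : ballNorm n h 0 = 0 := by
  have h1 : ∫⁻ r in Ioi (0 : ℝ), ENNReal.ofReal (r ^ (n - 1) * Real.exp (-h (r • 0))) = ∞ := by
    refine top_unique ?_
    calc ∞ = ∫⁻ r in Ioi (1 : ℝ), ENNReal.ofReal (Real.exp (-h 0)) := by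
          simp [ENNReal.mul_top, Real.exp_pos]
      _ ≤ ∫⁻ r in Ioi (1 : ℝ), ENNReal.ofReal (r ^ (n - 1) * Real.exp (-h (r • 0))) := by
          refine setLIntegral_mono' measurableSet_Ioi fun r hr => ENNReal.ofReal_le_ofReal ?_
          rw [smul_zero]
          exact le_mul_of_one_le_left (Real.exp_pos _).le (one_le_pow₀ (le_of_lt hr))
      _ ≤ _ := lintegral_mono_set (Ioi_subset_Ioi zero_le_one)
  have hn' : (0 : ℝ) < n := by exact_mod_cast hn
  rw [ballNorm, h1, ENNReal.mul_top (ENNReal.inv_ne_zero.2 (ENNReal.natCast_ne_top _)),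
    ENNReal.top_rpow_of_neg]
  rw [neg_lt_zero]
  positivity

theorem integral_pow_mul_comp_smul (m : ℕ) (f : E → ℝ) {t : ℝ} (ht : 0 < t) (y : E) :
    ∫ r in Ioi (0 : ℝ), r ^ m * f (r • y) =
      t ^ (m + 1) * ∫ r in Ioi (0 : ℝ), r ^ m * f (r • t • y) := by
  have h1 := integral_comp_mul_left_Ioi (fun r : ℝ => r ^ m * f (r • y)) 0 ht
  rw [mul_zero, smul_eq_mul, eq_inv_mul_iff_mul_eq₀ ht.ne'] at h1
  rw [← h1, pow_succ', mul_assoc, ← integral_const_mul (t ^ m)]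
  congr 2 with r
  rw [smul_smul, mul_comm r t]
  ring

variable [FiniteDimensional ℝ E] {h : E → ℝ}

/-- Coercivity dominates the integrand by `exp C` times a Gamma integrand with rate `c * ‖y‖`. The
explicit upper bound later yields the lower bound on the gauge. -/
theorem integrableOn_pow_mul_exp_neg (m : ℕ) (hconv : ConvexOn ℝ univ h) {c C : ℝ} (hc : 0 < c)
    (hlow : ∀ y, c * ‖y‖ - C ≤ h y) {y : E} (hy : y ≠ 0) :
    IntegrableOn (fun r : ℝ => r ^ m * Real.exp (-h (r • y))) (Ioi 0) ∧
      ∫ r in Ioi (0 : ℝ), r ^ m * Real.exp (-h (r • y)) ≤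
        Real.exp C * ((1 / (c * ‖y‖)) ^ (m + 1) * m !) ∧
      0 < ∫ r in Ioi (0 : ℝ), r ^ m * Real.exp (-h (r • y)) := by
  have hcont : Continuous h := continuousOn_univ.1 (hconv.continuousOn isOpen_univ)
  have hcy : 0 < c * ‖y‖ := mul_pos hc (norm_pos_iff.2 hy)
  have hgam := Real.integral_rpow_mul_exp_neg_mul_Ioi (a := m + 1) (r := c * ‖y‖) (by positivity) hcy
  rw [add_sub_cancel_right, Real.Gamma_nat_eq_factorial] at hgam
  have hpow : (1 / (c * ‖y‖)) ^ ((m : ℝ) + 1) = (1 / (c * ‖y‖)) ^ (m + 1) := by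
    rw [← Real.rpow_natCast]
    push_cast
    rfl
  simp only [Real.rpow_natCast] at hgam
  rw [hpow] at hgam
  have hgi : IntegrableOn (fun r : ℝ => r ^ m * Real.exp (-(c * ‖y‖ * r))) (Ioi 0) := by
    -- A non-integrable function has integral `0` by convention, contradicting the positive Gamma
    -- value.
    by_contra hni
    rw [integral_undef hni] at hgam
    have : 0 < (1 / (c * ‖y‖)) ^ (m + 1) * (m ! : ℝ) := by positivity
    linarith
  have hle : ∀ r ∈ Ioi (0 : ℝ), r ^ m * Real.exp (-h (r • y)) ≤
      Real.exp C * (r ^ m * Real.exp (-(c * ‖y‖ * r))) := by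
    intro r hr
    replace hr : 0 < r := hr
    have h1 := hlow (r • y)
    rw [norm_smul, Real.norm_of_nonneg hr.le] at h1
    rw [mul_left_comm, ← Real.exp_add]
    refine mul_le_mul_of_nonneg_left (Real.exp_le_exp.2 ?_) (by positivity)
    linarith
  have hcf : Continuous fun r : ℝ => r ^ m * Real.exp (-h (r • y)) := by fun_prop
  have hint : IntegrableOn (fun r : ℝ => r ^ m * Real.exp (-h (r • y))) (Ioi 0) := by
    refine Integrable.mono' (hgi.const_mul (Real.exp C)) hcf.aestronglyMeasurable ?_
    refine (ae_restrict_mem measurableSet_Ioi).mono fun r hr => ?_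
    rw [Real.norm_of_nonneg]
    · exact hle r hr
    · replace hr : 0 < r := hr
      positivity
  refine ⟨hint, ?_, ?_⟩
  · rw [← hgam, ← integral_const_mul]
    exact setIntegral_mono_on hint (hgi.const_mul _) measurableSet_Ioi hle
  · rw [setIntegral_pos_iff_support_of_nonneg_ae]
    · refine (by simp : (0 : ℝ≥0∞) < volume (Ioi (0 : ℝ))).trans_le (measure_mono fun r hr => ?_)
      refine ⟨?_, hr⟩
      replace hr : 0 < r := hr
      rw [Function.mem_support]
      positivity
    · refine (ae_restrict_mem measurableSet_Ioi).mono fun r hr => ?_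
      replace hr : 0 < r := hr
      simp only [Pi.zero_apply]
      positivity
    · exact hint

theorem ballNorm_eq_ofReal {n : ℕ} (hconv : ConvexOn ℝ univ h) {c C : ℝ} (hc : 0 < c)
    (hlow : ∀ y, c * ‖y‖ - C ≤ h y) {y : E} (hy : y ≠ 0) :
    ballNorm n h y = ENNReal.ofReal ((((n - 1)! : ℝ)⁻¹ *
      ∫ r in Ioi (0 : ℝ), r ^ (n - 1) * Real.exp (-h (r • y))) ^ (-(1 / (n : ℝ)))) := by
  obtain ⟨hint, -, hpos⟩ := integrableOn_pow_mul_exp_neg (n - 1) hconv hc hlow hy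
  rw [ballNorm, ← ofReal_integral_eq_lintegral_ofReal hint, ← ENNReal.ofReal_rpow_of_pos,
    ENNReal.ofReal_mul (by positivity), ENNReal.ofReal_inv_of_pos (by positivity),
    ENNReal.ofReal_natCast]
  · positivity
  · refine (ae_restrict_mem measurableSet_Ioi).mono fun r hr => ?_
    replace hr : 0 < r := hr
    simp only [Pi.zero_apply]
    positivity

theorem ballNorm_ne_top {n : ℕ} (hn : 1 ≤ n) (hconv : ConvexOn ℝ univ h) {c C : ℝ} (hc : 0 < c)
    (hlow : ∀ y, c * ‖y‖ - C ≤ h y) (y : E) : ballNorm n h y ≠ ∞ := by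
  rcases eq_or_ne y 0 with rfl | hy
  · simp [ballNorm_zero hn]
  · rw [ballNorm_eq_ofReal hconv hc hlow hy]
    exact ENNReal.ofReal_ne_top

/-- Ball's theorem: the functional `ballNorm` of a coercive convex function is a gauge. -/
theorem isGauge_ballNorm {n : ℕ} (hn : 1 ≤ n) (hconv : ConvexOn ℝ univ h) {c C : ℝ} (hc : 0 < c)
    (hlow : ∀ y, c * ‖y‖ - C ≤ h y) : IsGauge fun y => (ballNorm n h y).toReal := by
  obtain ⟨m, rfl⟩ : ∃ m, n = m + 1 := ⟨n - 1, by omega⟩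
  have hcont : Continuous h := continuousOn_univ.1 (hconv.continuousOn isOpen_univ)
  set J : E → ℝ := fun y => ∫ r in Ioi (0 : ℝ), r ^ m * Real.exp (-h (r • y))
  set k : ℝ := (m ! : ℝ)⁻¹
  set e : ℝ := -(1 / ((m + 1 : ℕ) : ℝ)) with he
  have hk : 0 < k := by positivity
  have hJ : ∀ y ≠ 0, 0 < J y := fun y hy =>
    (integrableOn_pow_mul_exp_neg m hconv hc hlow hy).2.2
  have h0 : (ballNorm (m + 1) h 0).toReal = 0 := by rw [ballNorm_zero hn, ENNReal.toReal_zero]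
  have hN : ∀ y ≠ 0, (ballNorm (m + 1) h y).toReal = (k * J y) ^ e := by
    intro y hy
    rw [ballNorm_eq_ofReal hconv hc hlow hy, ENNReal.toReal_ofReal]
    · simp [k, J, e]
    · have := hJ y hy
      exact (Real.rpow_pos_of_pos (mul_pos hk this) _).le
  have hme : ((m + 1 : ℕ) : ℝ) * e = -1 := by
    rw [he]
    field_simp
  have hpow : ∀ {x : ℝ}, 0 < x → (((x ^ (m + 1))⁻¹ : ℝ)) ^ e = x := by
    intro x hx
    rw [Real.inv_rpow (by positivity), ← Real.rpow_natCast, ← Real.rpow_mul hx.le, hme,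
      Real.rpow_neg_one, inv_inv]
  have hpow' : ∀ {x : ℝ}, 0 < x → ((x ^ e) ^ (m + 1))⁻¹ = x := by
    intro x hx
    rw [← Real.rpow_natCast, ← Real.rpow_mul hx.le, mul_comm, hme, Real.rpow_neg_one, inv_inv]
  have he0 : e ≤ 0 := by rw [he, neg_nonpos]; positivity
  refine ⟨fun t ht y => ?_, fun x y => ?_, ?_⟩
  · rcases ht.eq_or_lt with rfl | ht
    · simp [h0]
    rcases eq_or_ne y 0 with rfl | hy
    · simp [h0]
    have hty : t • y ≠ 0 := smul_ne_zero ht.ne' hy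
    rw [hN y hy, hN _ hty]
    have h1 : J y = t ^ (m + 1) * J (t • y) :=
      integral_pow_mul_comp_smul m (fun y => Real.exp (-h y)) ht y
    have h2 : k * J (t • y) = (t ^ (m + 1))⁻¹ * (k * J y) := by
      rw [h1]
      field_simp
    rw [h2, Real.mul_rpow (by positivity) (mul_pos hk (hJ y hy)).le, hpow ht]
  · rcases eq_or_ne x 0 with rfl | hx
    · simp [h0]
    rcases eq_or_ne y 0 with rfl | hy
    · simp [h0]
    rcases eq_or_ne (x + y) 0 with hxy | hxy
    · rw [hxy, h0]
      positivity
    rw [hN x hx, hN y hy, hN _ hxy, Real.mul_rpow hk.le (hJ x hx).le,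
      Real.mul_rpow hk.le (hJ y hy).le, Real.mul_rpow hk.le (hJ _ hxy).le, ← mul_add]
    refine mul_le_mul_of_nonneg_left ?_ (Real.rpow_nonneg hk.le _)
    have hx' : 0 < J x ^ e := Real.rpow_pos_of_pos (hJ x hx) _
    have hy' : 0 < J y ^ e := Real.rpow_pos_of_pos (hJ y hy) _
    -- Ball's inequality is applied with `J x ^ e` and `J y ^ e`, whose powers `-(m + 1)` are `J x`
    -- and `J y`. The harmonic-mean hypothesis is convexity of `h` at `r • x` and `s • y` with
    -- weights `s / (r + s)` and `r / (r + s)`, whose combination is `(r * s / (r + s)) • (x + y)`.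
    have key := ofReal_inv_add_pow_le_lintegral (m := m) (F := fun r => Real.exp (-h (r • x)))
      (G := fun r => Real.exp (-h (r • y))) (H := fun r => Real.exp (-h (r • (x + y))))
      (by fun_prop) (by fun_prop) (fun r => Real.exp_pos _) (fun r => Real.exp_pos _) hx' hy'
      (integrableOn_pow_mul_exp_neg m hconv hc hlow hx).1
      (integrableOn_pow_mul_exp_neg m hconv hc hlow hy).1
      (hpow' (hJ x hx)).symm (hpow' (hJ y hy)).symm (by
        intro r s hr hs
        rw [← Real.exp_mul, ← Real.exp_mul, ← Real.exp_add]
        refine Real.exp_le_exp.2 ?_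
        have hsum : s / (r + s) + r / (r + s) = 1 := by
          field_simp
          ring
        have := hconv.2 (mem_univ (r • x)) (mem_univ (s • y)) (by positivity) (by positivity) hsum
        rw [smul_smul, smul_smul, show s / (r + s) * r = r * s / (r + s) by ring,
          show r / (r + s) * s = r * s / (r + s) by ring, ← smul_add, smul_eq_mul,
          smul_eq_mul] at this
        linarith)
    rw [← ofReal_integral_eq_lintegral_ofReal
      (integrableOn_pow_mul_exp_neg m hconv hc hlow hxy).1
      ((ae_restrict_mem measurableSet_Ioi).mono fun r hr => by
        replace hr : 0 < r := hr
        simp only [Pi.zero_apply]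
        positivity), ENNReal.ofReal_le_ofReal_iff (hJ _ hxy).le] at key
    calc J (x + y) ^ e ≤ (((J x ^ e + J y ^ e) ^ (m + 1))⁻¹) ^ e :=
          Real.rpow_le_rpow_of_nonpos (by positivity) key he0
      _ = _ := hpow (by positivity)
  -- The Gamma bound reads `k * J y ≤ exp C * (c * ‖y‖) ^ (-(m + 1))`; raising it to the negative
  -- power `e` gives this constant.
  · refine ⟨c * Real.exp C ^ e, by positivity, fun y => ?_⟩
    rcases eq_or_ne y 0 with rfl | hy
    · simp [h0]
    have hcy : 0 < c * ‖y‖ := mul_pos hc (norm_pos_iff.2 hy)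
    rw [hN y hy]
    have h1 : k * J y ≤ Real.exp C * ((c * ‖y‖) ^ (m + 1))⁻¹ := by
      have h2 := (integrableOn_pow_mul_exp_neg m hconv hc hlow hy).2.1
      have h3 : k * J y ≤ k * (Real.exp C * ((1 / (c * ‖y‖)) ^ (m + 1) * m !)) :=
        mul_le_mul_of_nonneg_left h2 hk.le
      refine h3.trans_eq ?_
      simp only [k, one_div, inv_pow]
      field_simp
    calc c * Real.exp C ^ e * ‖y‖ = (Real.exp C * ((c * ‖y‖) ^ (m + 1))⁻¹) ^ e := by
          rw [Real.mul_rpow (Real.exp_pos _).le (by positivity), hpow hcy]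
          ring
      _ ≤ _ := Real.rpow_le_rpow_of_nonpos (mul_pos hk (hJ y hy)) h1 he0

end BallNorm

/-! ### Convexity and coercivity of the `L_p` support functions -/

section SupportFunctions

variable {n : ℕ} {K : ConvexBody (EuclideanSpace ℝ (Fin n))}

local notation "𝔼" => EuclideanSpace ℝ (Fin n)

theorem convexOn_supportFun : ConvexOn ℝ univ (supportFun (K : Set 𝔼)) := by
  have hb : ∀ y, BddAbove ((fun x => inner ℝ x y) '' (K : Set 𝔼)) := fun y =>
    (K.isCompact.image (by fun_prop)).bddAbove
  refine ⟨convex_univ, fun y _ z _ a b ha hb' _ => ?_⟩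
  refine csSup_le (K.nonempty.image _) ?_
  rintro _ ⟨x, hx, rfl⟩
  simp only [inner_add_right, inner_smul_right, smul_eq_mul]
  gcongr
  · exact le_csSup (hb y) ⟨x, hx, rfl⟩
  · exact le_csSup (hb z) ⟨x, hx, rfl⟩

theorem exists_le_supportFun (hK : (0 : 𝔼) ∈ interior (K : Set 𝔼)) :
    ∃ c > 0, ∃ C, ∀ y, c * ‖y‖ - C ≤ supportFun (K : Set 𝔼) y := by
  obtain ⟨ε, hε, hball⟩ := Metric.isOpen_iff.1 isOpen_interior 0 hK
  refine ⟨ε / 2, by positivity, 0, fun y => ?_⟩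
  have hb : BddAbove ((fun x => inner ℝ x y) '' (K : Set 𝔼)) :=
    (K.isCompact.image (by fun_prop)).bddAbove
  have hmem : (ε / 2) • ‖y‖⁻¹ • y ∈ (K : Set 𝔼) := by
    refine interior_subset (hball ?_)
    rw [mem_ball_zero_iff, norm_smul, norm_smul, norm_inv, norm_norm, Real.norm_of_nonneg
      (by positivity)]
    have : ‖y‖⁻¹ * ‖y‖ ≤ 1 := inv_mul_le_one
    nlinarith
  refine le_trans (le_of_eq ?_) (le_csSup hb ⟨_, hmem, rfl⟩)
  simp only [inner_smul_left, real_inner_self_eq_norm_sq]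
  rcases eq_or_ne ‖y‖ 0 with h | h
  · simp [h]
  · simp only [conj_trivial, sub_zero]
    field_simp

theorem integrableOn_exp_mul_inner (q : ℝ) (y : 𝔼) :
    IntegrableOn (fun x => Real.exp (q * inner ℝ x y)) (K : Set 𝔼) :=
  (by fun_prop : Continuous fun x : 𝔼 => Real.exp (q * inner ℝ x y)).continuousOn.integrableOn_compact
    K.isCompact

theorem ofReal_integral_exp_mul_inner (q : ℝ) (y : 𝔼) :
    ENNReal.ofReal (∫ x in (K : Set 𝔼), Real.exp (q * inner ℝ x y)) =
      ∫⁻ x in (K : Set 𝔼), ENNReal.ofReal (Real.exp (q * inner ℝ x y)) :=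
  ofReal_integral_eq_lintegral_ofReal (integrableOn_exp_mul_inner q y)
    (Filter.Eventually.of_forall fun _ => (Real.exp_pos _).le)

/-- Log-convexity of the Laplace transform of a convex body. -/
theorem integral_exp_mul_inner_le (q : ℝ) (y z : 𝔼) {a b : ℝ} (ha : 0 ≤ a) (hb : 0 ≤ b)
    (hab : a + b = 1) :
    ∫ x in (K : Set 𝔼), Real.exp (q * inner ℝ x (a • y + b • z)) ≤
      (∫ x in (K : Set 𝔼), Real.exp (q * inner ℝ x y)) ^ a *
        (∫ x in (K : Set 𝔼), Real.exp (q * inner ℝ x z)) ^ b := by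
  have hnn : ∀ y, 0 ≤ ∫ x in (K : Set 𝔼), Real.exp (q * inner ℝ x y) := fun y =>
    integral_nonneg fun _ => (Real.exp_pos _).le
  have hm : ∀ y, Measurable fun x : 𝔼 => ENNReal.ofReal (Real.exp (q * inner ℝ x y)) := fun y => by
    fun_prop
  -- Hölder's inequality with weights `a` and `b`.
  have h := ENNReal.lintegral_mul_norm_pow_le (μ := volume.restrict (K : Set 𝔼))
    (hm y).aemeasurable (hm z).aemeasurable ha hb hab
  rw [← ofReal_integral_exp_mul_inner, ← ofReal_integral_exp_mul_inner,
    ENNReal.ofReal_rpow_of_nonneg (hnn y) ha, ENNReal.ofReal_rpow_of_nonneg (hnn z) hb,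
    ← ENNReal.ofReal_mul (Real.rpow_nonneg (hnn y) _)] at h
  rw [← ENNReal.ofReal_le_ofReal_iff (mul_nonneg (Real.rpow_nonneg (hnn y) _)
    (Real.rpow_nonneg (hnn z) _)), ofReal_integral_exp_mul_inner]
  refine le_trans (le_of_eq ?_) h
  congr 1 with x
  rw [ENNReal.ofReal_rpow_of_pos (Real.exp_pos _), ENNReal.ofReal_rpow_of_pos (Real.exp_pos _),
    ← ENNReal.ofReal_mul (by positivity), ← Real.exp_mul, ← Real.exp_mul, ← Real.exp_add,
    inner_add_right, inner_smul_right, inner_smul_right]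
  congr 2
  ring

/-- The body contains the ball of radius `ε / 4` about `(ε / 2) • y / ‖y‖`, on which `⟪x, y⟫ ≥ (ε /
4) * ‖y‖`; the volume of that ball does not depend on `y`. -/
theorem exists_le_integral_exp (hK : (0 : 𝔼) ∈ interior (K : Set 𝔼)) {q : ℝ} (hq : 0 < q) :
    ∃ c > 0, ∃ b > 0, ∀ y,
      b * Real.exp (q * (c * ‖y‖)) ≤ ∫ x in (K : Set 𝔼), Real.exp (q * inner ℝ x y) := by
  obtain ⟨ε, hε, hball⟩ := Metric.isOpen_iff.1 isOpen_interior 0 hK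
  refine ⟨ε / 4, by positivity, volume.real (Metric.ball (0 : 𝔼) (ε / 4)),
    ENNReal.toReal_pos (Metric.measure_ball_pos _ _ (by positivity)).ne' measure_ball_lt_top.ne,
    fun y => ?_⟩
  set w : 𝔼 := (ε / 2) • ‖y‖⁻¹ • y
  have hw : ‖w‖ ≤ ε / 2 := by
    rw [norm_smul, norm_smul, norm_inv, norm_norm, Real.norm_of_nonneg (by positivity)]
    have : ‖y‖⁻¹ * ‖y‖ ≤ 1 := inv_mul_le_one
    nlinarith
  have hwy : inner ℝ w y = ε / 2 * ‖y‖ := by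
    simp only [w, inner_smul_left, real_inner_self_eq_norm_sq]
    rcases eq_or_ne ‖y‖ 0 with h | h
    · simp [h]
    · simp only [conj_trivial]
      field_simp
  have hsub : Metric.ball w (ε / 4) ⊆ (K : Set 𝔼) := fun x hx => by
    refine interior_subset (hball ?_)
    rw [mem_ball_iff_norm] at hx
    rw [mem_ball_zero_iff]
    have := norm_le_norm_add_norm_sub' x w
    linarith
  have hvol : volume.real (Metric.ball (0 : 𝔼) (ε / 4)) = volume.real (Metric.ball w (ε / 4)) := by
    rw [measureReal_def, measureReal_def, Measure.addHaar_ball_center volume w]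
  calc _ = ∫ _ in Metric.ball w (ε / 4), Real.exp (q * (ε / 4 * ‖y‖)) := by
        rw [setIntegral_const, smul_eq_mul, hvol]
    _ ≤ ∫ x in Metric.ball w (ε / 4), Real.exp (q * inner ℝ x y) := by
        refine setIntegral_mono_on (integrableOn_const measure_ball_lt_top.ne)
          ((integrableOn_exp_mul_inner q y).mono_set hsub) measurableSet_ball fun x hx => ?_
        rw [mem_ball_iff_norm] at hx
        have h1 : inner ℝ x y = ε / 2 * ‖y‖ + inner ℝ (x - w) y := by
          rw [inner_sub_left, hwy]
          ring
        have h2 := (abs_le.1 (abs_real_inner_le_norm (x - w) y)).1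
        have h3 : ‖x - w‖ * ‖y‖ ≤ ε / 4 * ‖y‖ := by gcongr
        gcongr
        linarith
    _ ≤ _ := setIntegral_mono_set (integrableOn_exp_mul_inner q y)
        (Filter.Eventually.of_forall fun _ => (Real.exp_pos _).le)
        (Filter.Eventually.of_forall hsub)

theorem lpSupportFun_eq_of_ne_top (hK : (0 : 𝔼) ∈ interior (K : Set 𝔼)) {p : ℝ≥0∞} (hp : 0 < p)
    (hp' : p ≠ ∞) (y : 𝔼) :
    lpSupportFun p (K : Set 𝔼) y = (p.toReal)⁻¹ *
      (Real.log (∫ x in (K : Set 𝔼), Real.exp (p.toReal * inner ℝ x y)) -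
        Real.log (volume.real (K : Set 𝔼))) := by
  have hq : 0 < p.toReal := ENNReal.toReal_pos hp.ne' hp'
  obtain ⟨c, -, b, hb, hI⟩ := exists_le_integral_exp hK hq
  have hIp : 0 < ∫ x in (K : Set 𝔼), Real.exp (p.toReal * inner ℝ x y) :=
    (mul_pos hb (Real.exp_pos _)).trans_le (hI y)
  have hv : 0 < volume.real (K : Set 𝔼) :=
    ENNReal.toReal_pos (Measure.measure_pos_of_nonempty_interior _ ⟨0, hK⟩).ne'
      K.isCompact.measure_lt_top.ne
  rw [lpSupportFun, if_neg hp', setAverage_eq, smul_eq_mul, Real.log_rpow (by positivity),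
    Real.log_mul (inv_pos.2 hv).ne' hIp.ne', Real.log_inv]
  ring

theorem convexOn_lpSupportFun (hK : (0 : 𝔼) ∈ interior (K : Set 𝔼)) {p : ℝ≥0∞} (hp : 0 < p) :
    ConvexOn ℝ univ (lpSupportFun p (K : Set 𝔼)) := by
  rcases eq_or_ne p ∞ with rfl | hp'
  · have : lpSupportFun ∞ (K : Set 𝔼) = supportFun (K : Set 𝔼) := by
      ext y
      simp [lpSupportFun]
    rw [this]
    exact convexOn_supportFun
  have hq : 0 < p.toReal := ENNReal.toReal_pos hp.ne' hp'
  obtain ⟨c, -, b, hb, hI⟩ := exists_le_integral_exp hK hq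
  have hIp : ∀ y, 0 < ∫ x in (K : Set 𝔼), Real.exp (p.toReal * inner ℝ x y) := fun y =>
    (mul_pos hb (Real.exp_pos _)).trans_le (hI y)
  refine ⟨convex_univ, fun y _ z _ a b ha hb hab => ?_⟩
  rw [lpSupportFun_eq_of_ne_top hK hp hp', lpSupportFun_eq_of_ne_top hK hp hp',
    lpSupportFun_eq_of_ne_top hK hp hp', smul_eq_mul, smul_eq_mul]
  have h := Real.log_le_log (hIp _) (integral_exp_mul_inner_le (K := K) p.toReal y z ha hb hab)
  rw [Real.log_mul (Real.rpow_pos_of_pos (hIp y) _).ne' (Real.rpow_pos_of_pos (hIp z) _).ne',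
    Real.log_rpow (hIp y), Real.log_rpow (hIp z)] at h
  have h' := mul_le_mul_of_nonneg_left h (inv_pos.2 hq).le
  have hv : (p.toReal)⁻¹ * Real.log (volume.real (K : Set 𝔼)) =
      (a + b) * ((p.toReal)⁻¹ * Real.log (volume.real (K : Set 𝔼))) := by rw [hab, one_mul]
  linarith

theorem exists_le_lpSupportFun (hK : (0 : 𝔼) ∈ interior (K : Set 𝔼)) {p : ℝ≥0∞} (hp : 0 < p) :
    ∃ c > 0, ∃ C, ∀ y, c * ‖y‖ - C ≤ lpSupportFun p (K : Set 𝔼) y := by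
  rcases eq_or_ne p ∞ with rfl | hp'
  · simpa [lpSupportFun] using exists_le_supportFun hK
  have hq : 0 < p.toReal := ENNReal.toReal_pos hp.ne' hp'
  obtain ⟨c, hc, b, hb, hI⟩ := exists_le_integral_exp hK hq
  refine ⟨c, hc, (p.toReal)⁻¹ * (Real.log (volume.real (K : Set 𝔼)) - Real.log b), fun y => ?_⟩
  rw [lpSupportFun_eq_of_ne_top hK hp hp']
  have h := Real.log_le_log (mul_pos hb (Real.exp_pos _)) (hI y)
  rw [Real.log_mul hb.ne' (Real.exp_pos _).ne', Real.log_exp] at h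
  have h' := mul_le_mul_of_nonneg_left h (inv_pos.2 hq).le
  rw [mul_add, inv_mul_cancel_left₀ hq.ne'] at h'
  linarith

/-- The `L_p` polar body is the unit ball of a gauge. -/
theorem exists_isGauge_lpPolar (hn : 1 ≤ n) (hK : (0 : 𝔼) ∈ interior (K : Set 𝔼)) {p : ℝ≥0∞}
    (hp : 0 < p) : ∃ N : 𝔼 → ℝ, IsGauge N ∧ lpPolar p (K : Set 𝔼) = {x | N x ≤ 1} := by
  obtain ⟨c, hc, C, hlow⟩ := exists_le_lpSupportFun hK hp
  have hconv := convexOn_lpSupportFun hK hp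
  refine ⟨_, isGauge_ballNorm hn hconv hc hlow, ?_⟩
  ext y
  have h := ENNReal.toReal_le_toReal (ballNorm_ne_top hn hconv hc hlow y) ENNReal.one_ne_top
  rw [ENNReal.toReal_one] at h
  exact h.symm

end SupportFunctions

theorem theorem1p4 (n : ℕ) (hn : 1 ≤ n) (p : ℝ≥0∞) (hp : 0 < p)
    (K L : ConvexBody (EuclideanSpace ℝ (Fin n)))
    (hK : (0 : EuclideanSpace ℝ (Fin n)) ∈ interior (K : Set (EuclideanSpace ℝ (Fin n))))
    (hL : (0 : EuclideanSpace ℝ (Fin n)) ∈ interior (L : Set (EuclideanSpace ℝ (Fin n))))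
    (hbar : barycenter (lpPolar p (K : Set (EuclideanSpace ℝ (Fin n)))) =
      -barycenter (lpPolar p (L : Set (EuclideanSpace ℝ (Fin n))))) :
    volume (lpPolar p (K : Set (EuclideanSpace ℝ (Fin n)))) *
        volume (lpPolar p (L : Set (EuclideanSpace ℝ (Fin n)))) ≤
      ((2 * n).choose n : ℝ≥0∞) *
        volume (convexHull ℝ (lpPolar p (K : Set (EuclideanSpace ℝ (Fin n))) ∪
          lpPolar p (L : Set (EuclideanSpace ℝ (Fin n))))) *
        volume (polarBody (polarBody (lpPolar p (K : Set (EuclideanSpace ℝ (Fin n)))) -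
          polarBody (lpPolar p (L : Set (EuclideanSpace ℝ (Fin n)))))) := by
  obtain ⟨M, hM, hKM⟩ := exists_isGauge_lpPolar hn hK hp
  obtain ⟨N, hN, hLN⟩ := exists_isGauge_lpPolar hn hL hp
  rw [hKM, hLN] at hbar ⊢
  refine (hM.volume_mul_volume_le hn hN hbar).trans ?_
  gcongr
  exact hM.subset_polarBody_sub hN
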